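/- **Definitions.** Let $\mathcal C$ be a category with an initial object $\emptyset$, a terminal object $*$ and three subcategories $\mathrm{cof}(\mathcal C)$ (cofibrations), $\mathrm{fib}(\mathcal C)$ (fibrations), $\mathrm{we}(\mathcal C)$ (weak equivalences), each containing all objects. An *equifibration* is a fibration that is a weak equivalence; an object $X$ is *fibrant* if $X\to *$ is a fibration. $\mathcal C$ is a *Thomason model category* if: * (TM0) every isomorphism is a cofibration, a fibration and a weak equivalence; * (TM1) the pushout of a cofibration $c\colon A\to X$ along any map $f\colon A\to B$ exists and $B\to B\sqcup_A X$ is a cofibration; if $c$ (resp. $f$) is a weak equivalence, so is its pushout $B\to B\sqcup_AX$ (resp. $X\to B\sqcup_A X$); and dually for the pullback of a fibration along any map; * (TM2) if two of $f$, $g$, $gf$ are weak equivalences, so is the third; * (TM3) retracts of weak equivalences are weak equivalences; * (TM4) every commutative square from a cofibration $i\colon A\to B$ to a fibration $p\colon X\to Y$ has a diagonal filler $B\to X$, provided $i$ or $p$ is a weak equivalence; * (TM5) every map $f\colon A\to B$ factors, functorially in $f$, as a cofibration followed by a weak equivalence, and also, functorially in $f$, as a weak equivalence followed by a fibration. Let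 $\mathcal S_f$ be the category of finite simplicial sets (cofibrations are the injections, weak equivalences the usual ones), and let $\mathcal C_{\mathrm{fib}}\subseteq\mathcal C$ be the full subcategory of fibrant objects. A complete Thomason model category $\mathcal C$ is *right enriched over $\mathcal S_f$* if there is a functor $\mathrm{Map}\colon\mathcal S_f^{\mathrm{op}}\times\mathcal C_{\mathrm{fib}}\to\mathcal C_{\mathrm{fib}}$ such that: * (RE1) for each $K$ in $\mathcal S_f$, $\mathrm{Map}(K,*)\cong *$, and $\mathrm{Map}(K,-)$ preserves fibrations between fibrant objects and pullbacks (of fibrant objects) along fibrations; * (RE2) for each fibrant $X$, $\mathrm{Map}(\emptyset,X)\cong *$, and $\mathrm{Map}(-,X)$ sends cofibrations to fibrations and pushouts along cofibrations to pullbacks; * (RE3) for each cofibration $i\colon K\to L$ in $\mathcal S_f$ and each fibration $p\colon B\to X$ of fibrant objects, $\mathrm{Map}(L,B)\to\mathrm{Map}(K,B)\times_{\mathrm{Map}(K,X)}\mathrm{Map}(L,X)$ is a fibration, and it is a weak equivalence if $i$ or $p$ is; * (RE4) there is a weak equivalence $\omega\colon X\to\mathrm{Map}(\Delta[0],X)$,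 natural in the fibrant object $X$ (its composites with any two maps $\mathrm{Map}(\Delta[0],X)\to\mathrm{Map}(\Delta[1],X)$ induced by simplicial maps $\Delta[1]\to\Delta[0]$ coincide); * (RE5) for each family $(X_i)_{i\in I}$ of fibrant objects indexed by a set $I$, and each $K$ in $\mathcal S_f$, $\prod X_i$ is fibrant and the canonical map $\mathrm{Map}(K,\prod X_i)\to\prod\mathrm{Map}(K,X_i)$ is an isomorphism. *Products preserve fibrations and equifibrations* in $\mathcal C$ if for every set $I$, every family $(X_i)_{i\in I}$ of fibrant objects and all fibrations (resp. equifibrations) $B_i\to X_i$, the map $\prod B_i\to\prod X_i$ is a fibration (resp. an equifibration). *Towers preserve fibrations and equifibrations* in $\mathcal C$ if for every map $(X_n)\to(Y_n)$ between towers of fibrations $\cdots\to X_1\to X_0\to *$ and $\cdots\to Y_1\to Y_0\to *$ such that $X_0\to Y_0$ and all $X_{n+1}\to X_n\times_{Y_n}Y_{n+1}$ ($n\ge 0$) are fibrations, the map $\varprojlim X_n\to\varprojlim Y_n$ is a fibration, and is moreover a weak equivalence if every $X_n\to Y_n$ is. For a small category $K$, the *global structure* on the functor category $\mathcal C^K$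 is the following: a natural transformation is a cofibration (resp. weak equivalence) if each of its components is one in $\mathcal C$; it is a fibration if each of its components is a fibration in $\mathcal C$ and it has the right lifting property with respect to all natural transformations that are both cofibrations and weak equivalences. **Theorem.** Let $\mathcal C$ be a complete Thomason model category that is right enriched over $\mathcal S_f$, in which products and towers preserve fibrations and equifibrations. Then for every small category $K$, the functor category $\mathcal C^K$ with the global structure is a Thomason model category. Moreover, $\mathcal C^K$ is right enriched over $\mathcal S_f$, and products and towers in $\mathcal C^K$ preserve fibrations and equifibrations. -/

import Mathlib

open CategoryTheory Limits Opposite Simplicial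

universe v u

namespace Thomason

/-! ### Simplicial sets -/

/-- A map `f : X ⟶ Y` of simplicial sets is a weak equivalence if for every Kan complex `Z`
precomposition with `f` is a bijection `[Y, Z] → [X, Z]` on simplicial homotopy classes.
(As `Z` is a Kan complex, being homotopic is an equivalence relation on maps into `Z`.) -/
def IsWeakEquivSSet {X Y : SSet.{0}} (f : X ⟶ Y) : Prop :=
  ∀ (Z : SSet.{0}) [SSet.KanComplex Z],
    (∀ g : X ⟶ Z, ∃ h : Y ⟶ Z, Nonempty (SSet.Homotopy (f ≫ h) g)) ∧
    (∀ h h' : Y ⟶ Z, Nonempty (SSet.Homotopy (f ≫ h) (f ≫ h')) → Nonempty (SSet.Homotopy h h'))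

/-- The category `𝒮_f` of finite simplicial sets (finitely many nondegenerate simplices). -/
abbrev FinSSet : Type 1 := ObjectProperty.FullSubcategory (fun X : SSet.{0} => X.Finite)

/-- The standard simplex as a finite simplicial set. -/
noncomputable def simplex (n : ℕ) : FinSSet := ⟨Δ[n], inferInstance⟩

/-! ### Model structures -/

/-- Three distinguished classes of morphisms: cofibrations, fibrations, weak equivalences. -/
structure ModelData (C : Type u) [Category.{v} C] where
  cof : MorphismProperty C
  fib : MorphismProperty C
  we : MorphismProperty C

namespace ModelData

section

variable {C : Type u} [Category.{v} C] (S : ModelData C)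

/-- Basic model categories: axioms (TM0)-(TM4) and (CM5). -/
structure IsBasicModel : Prop where
  hasInitial : HasInitial C
  hasTerminal : HasTerminal C
  /-- The three classes are subcategories containing all objects. -/
  cof_mul : S.cof.IsMultiplicative
  fib_mul : S.fib.IsMultiplicative
  we_mul : S.we.IsMultiplicative
  /-- (TM0) -/
  cof_iso : MorphismProperty.isomorphisms C ≤ S.cof
  fib_iso : MorphismProperty.isomorphisms C ≤ S.fib
  we_iso : MorphismProperty.isomorphisms C ≤ S.we
  /-- (TM1) for pushouts `P` of a cofibration `c : A ⟶ X` along `f : A ⟶ B` -/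
  hasPushout {A X B : C} (c : A ⟶ X) (f : A ⟶ B) : S.cof c → HasPushout c f
  cof_pushout {A X B P : C} {c : A ⟶ X} {f : A ⟶ B} {f' : X ⟶ P} {c' : B ⟶ P} :
    IsPushout c f f' c' → S.cof c → S.cof c'
  we_pushout_cof {A X B P : C} {c : A ⟶ X} {f : A ⟶ B} {f' : X ⟶ P} {c' : B ⟶ P} :
    IsPushout c f f' c' → S.cof c → S.we c → S.we c'
  we_pushout_along {A X B P : C} {c : A ⟶ X} {f : A ⟶ B} {f' : X ⟶ P} {c' : B ⟶ P} :
    IsPushout c f f' c' → S.cof c → S.we f → S.we f'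
  /-- (TM1) for pullbacks `P` of a fibration `p : X ⟶ A` along `f : B ⟶ A` -/
  hasPullback {A X B : C} (p : X ⟶ A) (f : B ⟶ A) : S.fib p → HasPullback p f
  fib_pullback {A X B P : C} {f' : P ⟶ X} {p' : P ⟶ B} {p : X ⟶ A} {f : B ⟶ A} :
    IsPullback f' p' p f → S.fib p → S.fib p'
  we_pullback_fib {A X B P : C} {f' : P ⟶ X} {p' : P ⟶ B} {p : X ⟶ A} {f : B ⟶ A} :
    IsPullback f' p' p f → S.fib p → S.we p → S.we p'
  we_pullback_along {A X B P : C} {f' : P ⟶ X} {p' : P ⟶ B} {p : X ⟶ A} {f : B ⟶ A} :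
    IsPullback f' p' p f → S.fib p → S.we f → S.we f'
  /-- (TM2) -/
  saturated : S.we.HasTwoOutOfThreeProperty
  /-- (TM3) -/
  retract : S.we.IsStableUnderRetracts
  /-- (TM4) -/
  lifting {A B X Y : C} (i : A ⟶ B) (p : X ⟶ Y) :
    S.cof i → S.fib p → (S.we i ∨ S.we p) → HasLiftingProperty i p
  /-- (CM5) -/
  factor_cof : S.cof.HasFactorization S.we
  factor_fib : S.we.HasFactorization S.fib

/-- Thomason model categories: basic model categories in which the factorizations
can be chosen functorially (TM5). -/
structure IsThomasonModel : Prop extends S.IsBasicModel where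
  functorial_cof : S.cof.HasFunctorialFactorization S.we
  functorial_fib : S.we.HasFunctorialFactorization S.fib

/-- `X` is fibrant if `X ⟶ *` is a fibration. -/
def IsFibrant [HasTerminal C] : ObjectProperty C := fun X => S.fib (terminal.from X)

/-- The full subcategory `C_fib` of fibrant objects. -/
abbrev Fibrant [HasTerminal C] := ObjectProperty.FullSubcategory S.IsFibrant

/-- The global structure on a functor category: cofibrations and weak equivalences are
pointwise; fibrations are the pointwise fibrations having the right lifting property with
respect to all pointwise trivial cofibrations. -/
def global (K : Type v) [SmallCategory K] : ModelData (K ⥤ C) where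
  cof := S.cof.functorCategory K
  we := S.we.functorCategory K
  fib := S.fib.functorCategory K ⊓ (S.cof.functorCategory K ⊓ S.we.functorCategory K).rlp

end

section

variable {C : Type u} [Category.{v} C] [HasLimits C] (S : ModelData C)

/-- A right enrichment over finite simplicial sets: a mapping object functor
`Map : 𝒮_fᵒᵖ × C_fib ⥤ C_fib` (curried) satisfying (RE1)-(RE5).
All limits are taken in `C`. -/
structure RightEnrichment where
  Map : FinSSetᵒᵖ ⥤ S.Fibrant ⥤ S.Fibrant
  /-- (RE1) -/
  map_terminal (K : FinSSet) (T : S.Fibrant) :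
    Nonempty (IsTerminal T.obj) → Nonempty (IsTerminal ((Map.obj (op K)).obj T).obj)
  map_fib (K : FinSSet) {B X : S.Fibrant} (p : B ⟶ X) :
    S.fib p.hom → S.fib ((Map.obj (op K)).map p).hom
  map_baseChange (K : FinSSet) {P B X Y : S.Fibrant}
      (q : P ⟶ B) (p' : P ⟶ Y) (p : B ⟶ X) (f : Y ⟶ X) :
    S.fib p.hom → IsPullback q.hom p'.hom p.hom f.hom →
      IsPullback ((Map.obj (op K)).map q).hom ((Map.obj (op K)).map p').hom
        ((Map.obj (op K)).map p).hom ((Map.obj (op K)).map f).hom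
  /-- (RE2) -/
  map_empty (E : FinSSet) (X : S.Fibrant) :
    Nonempty (IsInitial E.obj) → Nonempty (IsTerminal ((Map.obj (op E)).obj X).obj)
  map_cof {K L : FinSSet} (i : K ⟶ L) (X : S.Fibrant) :
    Mono i.hom → S.fib ((Map.map i.op).app X).hom
  map_pushout {K L K' P : FinSSet} (i : K ⟶ L) (f : K ⟶ K') (f' : L ⟶ P) (i' : K' ⟶ P)
      (X : S.Fibrant) :
    Mono i.hom → IsPushout i.hom f.hom f'.hom i'.hom →
      IsPullback ((Map.map f'.op).app X).hom ((Map.map i'.op).app X).hom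
        ((Map.map i.op).app X).hom ((Map.map f.op).app X).hom
  /-- (RE3) -/
  corner_fib {K L : FinSSet} (i : K ⟶ L) {B X : S.Fibrant} (p : B ⟶ X) :
    Mono i.hom → S.fib p.hom →
      S.fib (pullback.lift
        (f := ((Map.obj (op K)).map p).hom) (g := ((Map.map i.op).app X).hom)
        ((Map.map i.op).app B).hom ((Map.obj (op L)).map p).hom
        (congrArg (fun m => m.hom) ((Map.map i.op).naturality p).symm))
  corner_we {K L : FinSSet} (i : K ⟶ L) {B X : S.Fibrant} (p : B ⟶ X) :
    Mono i.hom → S.fib p.hom → (IsWeakEquivSSet i.hom ∨ S.we p.hom) →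
      S.we (pullback.lift
        (f := ((Map.obj (op K)).map p).hom) (g := ((Map.map i.op).app X).hom)
        ((Map.map i.op).app B).hom ((Map.obj (op L)).map p).hom
        (congrArg (fun m => m.hom) ((Map.map i.op).naturality p).symm))
  /-- (RE4) -/
  ω : 𝟭 S.Fibrant ⟶ Map.obj (op (simplex 0))
  ω_we (X : S.Fibrant) : S.we (ω.app X).hom
  ω_comm (X : S.Fibrant) (d d' : simplex 1 ⟶ simplex 0) :
    ω.app X ≫ (Map.map d.op).app X = ω.app X ≫ (Map.map d'.op).app X
  /-- (RE5) -/
  prod_fibrant {I : Type v} (X : I → S.Fibrant) : S.IsFibrant (∏ᶜ fun i => (X i).obj)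
  map_prod (K : FinSSet) {I : Type v} (X : I → S.Fibrant) :
    IsIso (Pi.lift fun i => ((Map.obj (op K)).map
      (ObjectProperty.homMk (Pi.π (fun j => (X j).obj) i) :
        (⟨∏ᶜ fun j => (X j).obj, prod_fibrant X⟩ : S.Fibrant) ⟶ X i)).hom)

/-- Products preserve fibrations and equifibrations. (All products exist in `C`.) -/
def ProductsPreserve : Prop :=
  ∀ (I : Type v) (B X : I → C) (f : ∀ i, B i ⟶ X i),
    (∀ i, S.IsFibrant (X i)) → (∀ i, S.fib (f i)) →
      S.fib (Limits.Pi.map f) ∧ ((∀ i, S.we (f i)) → S.we (Limits.Pi.map f))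

/-- The transition map `X_{n+1} ⟶ X_n` of a tower. -/
abbrev step (X : ℕᵒᵖ ⥤ C) (n : ℕ) : X.obj (op (n + 1)) ⟶ X.obj (op n) :=
  X.map (homOfLE (Nat.le_succ n)).op

/-- A tower of fibrations `⋯ ⟶ X₁ ⟶ X₀ ⟶ *`. -/
def IsFibTower (X : ℕᵒᵖ ⥤ C) : Prop :=
  S.IsFibrant (X.obj (op 0)) ∧ ∀ n, S.fib (step X n)

/-- Towers preserve fibrations and equifibrations. -/
def TowersPreserve : Prop :=
  ∀ (X Y : ℕᵒᵖ ⥤ C) (η : X ⟶ Y), S.IsFibTower X → S.IsFibTower Y →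
    S.fib (η.app (op 0)) →
    (∀ n, S.fib (pullback.lift (f := η.app (op n)) (g := step Y n)
      (step X n) (η.app (op (n + 1))) (η.naturality _))) →
    S.fib (limMap η) ∧ ((∀ n, S.we (η.app (op n))) → S.we (limMap η))

end

end ModelData

end Thomason

/-! Apart from one factorization, the model axioms for diagrams follow from those of `C` at each
object of `K`, together with formal properties of lifting. The difficulty is to factor a map A ⟶ B
of diagrams functorially into a pointwise weak equivalence and a global fibration.

The tool is a functor `hoEnd` on pointwise fibrant diagrams. It comes with a natural pointwise weak
equivalence X ⟶ hoEnd X (`we_toHoEnd`), turns pointwise fibrations into global ones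
(`fib_hoEnd_map`), and preserves products and pullbacks along pointwise fibrations. With it, choose
a pointwise fibrant replacement B ⟶ RB, factor A ⟶ RB pointwise as a weak equivalence A ⟶ Q and a
fibration Q ⟶ RB, and pull hoEnd Q ⟶ hoEnd RB back along B ⟶ RB ⟶ hoEnd RB. The result is a global
fibration over B, and A maps to its source by a weak equivalence, by properness and two out of three
(`global_functorial_fib`).

Construction of `hoEnd`: let T be the cofree monad, (TX)(k) = ∏ X(l) over all arrows k ⟶ l. A
natural map into TX is an arbitrary family of maps into the X(k), so T sends pointwise fibrations
with fibrant targets to global fibrations (`fib_cofreeMonad`). Put E₀ = *. Given X ⟶ Eₙ, the mapping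
path object yields X ⟶ Hₙ ⟶ Eₙ, pointwise a weak equivalence followed by a fibration. Set Eₙ₊₁ = Eₙ
×_{TEₙ} THₙ and hoEnd X = lim Eₙ; the transition maps are global fibrations, being base changes of
THₙ ⟶ TEₙ. At a fixed k the map Eₙ₊₁(k) ⟶ Eₙ(k) factors through Hₙ(k) by two fibrations. So lim
Eₙ(k) = lim Hₙ(k), the limit of a tower of trivial fibrations whose terms are weakly equivalent to
X(k).

Relative forms of these steps, phrased with `CornerMap`, give `fib_hoEnd_map`. The enrichment sends
(L, X) to hoEnd of k ↦ Map(L, X(k)), and its axioms are the pointwise ones carried through `hoEnd`.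
Products and towers preserve global fibrations because lifts can be formed factor by factor or stage
by stage. -/

namespace Thomason

/-! ### Anodyne maps and the interval -/

section

open MonoidalCategory CartesianMonoidalCategory SSet modelCategoryQuillen

/-- `∂Δ[1]` is the disjoint union of its two vertices. -/
lemma boundary_one_isPushout :
    IsPushout ((Subcomplex.isInitialBot (X := Δ[1])).to Δ[0])
      ((Subcomplex.isInitialBot (X := Δ[1])).to Δ[0])
      (boundary.ι.{0} (0 : Fin 2)) (boundary.ι.{0} (1 : Fin 2)) := by
  have sq : Subcomplex.BicartSq.{0} (X := Δ[1]) ⊥ (stdSimplex.face {0}ᶜ)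
      (stdSimplex.face {1}ᶜ) ∂Δ[1] :=
    { sup_eq := by
        rw [boundary_eq_iSup]
        apply le_antisymm
        · exact sup_le (le_iSup (fun i : Fin 2 => stdSimplex.face.{0} {i}ᶜ) 0)
            (le_iSup (fun i : Fin 2 => stdSimplex.face.{0} {i}ᶜ) 1)
        · refine iSup_le fun i => ?_
          fin_cases i
          · exact le_sup_left
          · exact le_sup_right
      inf_eq := by
        rw [stdSimplex.face_inter_face, show ({0}ᶜ ⊓ {1}ᶜ : Finset (Fin 2)) = ∅ by decide]
        simp }
  refine sq.isPushout.of_iso (Iso.refl _) (stdSimplex.faceSingletonComplIso 0).symm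
    (stdSimplex.faceSingletonComplIso 1).symm (Iso.refl _) (Subcomplex.isInitialBot.hom_ext _ _)
    (Subcomplex.isInitialBot.hom_ext _ _) ?_ ?_
  · simp; rfl
  · simp; rfl

lemma exists_extension_of_anodyne {X Y Z : SSet.{0}} [KanComplex Z] {i : X ⟶ Y}
    (hi : anodyneExtensions i) (g : X ⟶ Z) : ∃ h : Y ⟶ Z, i ≫ h = g := by
  have := hi (terminal.from Z)
    ((HomotopicalAlgebra.fibration_iff _).1 inferInstance)
  have sq : CommSq g i (terminal.from Z) (terminal.from Y) := ⟨Subsingleton.elim _ _⟩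
  exact ⟨sq.lift, sq.fac_left⟩

/-- Two maps `Y ⟶ Z` glue to a map `Y ⊗ ∂Δ[1] ⟶ Z`. -/
lemma exists_tensor_boundary_desc {Y Z : SSet.{0}} (h₁ h₀ : Y ⟶ Z) :
    ∃ b : Y ⊗ (∂Δ[1] : SSet.{0}) ⟶ Z, Y ◁ boundary.ι 0 ≫ b = fst _ _ ≫ h₁ ∧
      Y ◁ boundary.ι 1 ≫ b = fst _ _ ≫ h₀ := by
  have sq := boundary_one_isPushout.map (tensorLeft Y)
  have hI := (Subcomplex.isInitialBot (X := (Δ[1] : SSet.{0}))).isInitialObj (tensorLeft Y)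
  exact ⟨sq.desc (fst _ _ ≫ h₁) (fst _ _ ≫ h₀) (hI.hom_ext _ _), sq.inl_desc _ _ _,
    sq.inr_desc _ _ _⟩

lemma tensor_boundary_hom_ext {X Z : SSet.{0}} {a b : X ⊗ (∂Δ[1] : SSet.{0}) ⟶ Z}
    (h₁ : X ◁ boundary.ι 0 ≫ a = X ◁ boundary.ι 0 ≫ b)
    (h₀ : X ◁ boundary.ι 1 ≫ a = X ◁ boundary.ι 1 ≫ b) : a = b :=
  (boundary_one_isPushout.map (tensorLeft X)).hom_ext h₁ h₀

instance (Y : SSet.{0}) : Epi (fst Y Δ[0]) :=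
  epi_of_epi_fac (lift_fst (𝟙 Y) (SSet.const (stdSimplex.obj₀Equiv.symm 0)))

/-- The face `δ 0` omits the vertex 0, so it is the end `ι₁` of the cylinder: the indices of faces
and of ends are crossed. -/
lemma whiskerLeft_δ_zero (X : SSet.{0}) :
    X ◁ stdSimplex.δ (0 : Fin 2) = fst X Δ[0] ≫ ι₁ := by
  rw [stdSimplex.δ_zero_eq_const]; rfl

lemma whiskerLeft_δ_one (X : SSet.{0}) :
    X ◁ stdSimplex.δ (1 : Fin 2) = fst X Δ[0] ≫ ι₀ := by
  rw [stdSimplex.δ_one_eq_const]; rfl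

/-- Surjectivity on homotopy classes is extension along `i`. For injectivity, `h`, `h'` and the
homotopy on `X` glue to a map on the source of the pushout-product of `i` with ∂Δ[1] ⊆ Δ[1]; this is
again anodyne, and an extension is the homotopy on `Y`. -/
lemma isWeakEquivSSet_of_anodyne {X Y : SSet.{0}} (i : X ⟶ Y) (hi : anodyneExtensions i) :
    IsWeakEquivSSet i := by
  intro Z _
  refine ⟨fun g => ?_, fun h h' ⟨H⟩ => ?_⟩
  · obtain ⟨h, rfl⟩ := exists_extension_of_anodyne hi g
    exact ⟨h, ⟨RelativeMorphism.Homotopy.refl _⟩⟩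
  · obtain ⟨b, hb₁, hb₀⟩ := exists_tensor_boundary_desc h' h
    let sq := Functor.PushoutObjObj.ofHasPushout (curriedTensor SSet) i ∂Δ[1].ι
    have comm : i ▷ (∂Δ[1] : SSet.{0}) ≫ b = X ◁ ∂Δ[1].ι ≫ H.h := by
      apply tensor_boundary_hom_ext
      · rw [whisker_exchange_assoc, hb₁, ← MonoidalCategory.whiskerLeft_comp_assoc, boundary.ι_ι,
          whiskerLeft_δ_zero, Category.assoc, H.h₁, whiskerRight_fst_assoc]
      · rw [whisker_exchange_assoc, hb₀, ← MonoidalCategory.whiskerLeft_comp_assoc, boundary.ι_ι,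
          whiskerLeft_δ_one, Category.assoc, H.h₀, whiskerRight_fst_assoc]
    obtain ⟨G, hG⟩ := exists_extension_of_anodyne (anodyneExtensions_pushoutObjObjι' sq hi)
      (sq.isPushout.desc b H.h comm)
    have hGb : Y ◁ ∂Δ[1].ι ≫ G = b := by
      have := sq.inl ≫= hG
      rw [sq.isPushout.inl_desc, sq.inl_ι_assoc] at this
      exact this
    have e₁ : ι₁ ≫ G = h' := by
      have := Y ◁ boundary.ι 0 ≫= hGb
      rw [hb₁, ← MonoidalCategory.whiskerLeft_comp_assoc, boundary.ι_ι, whiskerLeft_δ_zero,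
        Category.assoc] at this
      exact (cancel_epi _).1 this
    have e₀ : ι₀ ≫ G = h := by
      have := Y ◁ boundary.ι 1 ≫= hGb
      rw [hb₀, ← MonoidalCategory.whiskerLeft_comp_assoc, boundary.ι_ι, whiskerLeft_δ_one,
        Category.assoc] at this
      exact (cancel_epi _).1 this
    exact ⟨{ h := G, h₀ := e₀, h₁ := e₁, rel := (((Subcomplex.isInitialBot (X := Y)).isInitialObj
      (tensorRight Δ[1]))).hom_ext _ _ }⟩

lemma horn_one_eq_face {i j : Fin 2} (hij : j ≠ i) :
    Λ[1, i] = stdSimplex.face.{0} {j}ᶜ := by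
  rw [horn_eq_iSup]
  apply le_antisymm
  · refine iSup_le fun ⟨k, hk⟩ => ?_
    obtain rfl : k = j := by
      have : k ≠ i := hk
      omega
    exact le_rfl
  · exact le_iSup (fun k : ({i}ᶜ : Set (Fin 2)) => stdSimplex.face.{0} {k.1}ᶜ) ⟨j, hij⟩

/-- A horn in Δ[1] is a single vertex. Through the corner axiom of the enrichment this makes
evaluation of paths at a vertex a weak equivalence. -/
lemma anodyneExtensions_δ (j : Fin 2) : anodyneExtensions (stdSimplex.{0}.δ j) := by
  obtain ⟨i, hij⟩ : ∃ i : Fin 2, j ≠ i := ⟨j + 1, by fin_cases j <;> decide⟩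
  have h : anodyneExtensions (stdSimplex.face.{0} {j}ᶜ).ι := by
    rw [← horn_one_eq_face hij]
    exact anodyneExtensions.horn_ι i
  rw [← stdSimplex.faceSingletonComplIso_hom_ι]
  exact (anodyneExtensions.cancel_left_of_respectsIso _ _).2 h

end

/-! ### Corner maps -/

section Corner

variable {C : Type*} [Category* C]

/-- Given a commutative square with horizontal maps `f : X' ⟶ X`, `g : Y' ⟶ Y` and vertical maps
`a' : X' ⟶ Y'`, `a : X ⟶ Y`, the induced map `X' ⟶ X ×[Y] Y'` belongs to `W`. -/
def CornerMap (W : MorphismProperty C) {X' X Y' Y : C} (f : X' ⟶ X) (g : Y' ⟶ Y)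
    (a' : X' ⟶ Y') (a : X ⟶ Y) : Prop :=
  ∃ (P : C) (p₁ : P ⟶ X) (p₂ : P ⟶ Y') (l : X' ⟶ P),
    IsPullback p₁ p₂ a g ∧ l ≫ p₁ = f ∧ l ≫ p₂ = a' ∧ W l

namespace CornerMap

variable {W : MorphismProperty C} {X' X Y' Y : C} {f : X' ⟶ X} {g : Y' ⟶ Y}
    {a' : X' ⟶ Y'} {a : X ⟶ Y}

lemma of_isPullback [W.RespectsIso] (h : CornerMap W f g a' a) {P : C} {p₁ : P ⟶ X} {p₂ : P ⟶ Y'}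
    (sq : IsPullback p₁ p₂ a g) {l : X' ⟶ P} (h₁ : l ≫ p₁ = f) (h₂ : l ≫ p₂ = a') : W l := by
  obtain ⟨Q, q₁, q₂, m, sq', rfl, rfl, hm⟩ := h
  have : l = m ≫ (sq'.isoIsPullback _ _ sq).hom := sq.hom_ext (by simpa) (by simpa)
  rw [this]
  exact MorphismProperty.RespectsIso.postcomp _ _ _ hm

/-- `a'` is the corner map followed by a base change of `a`. -/
lemma of_comp [W.IsStableUnderBaseChange] [W.IsStableUnderComposition]
    (h : CornerMap W f g a' a) (ha : W a) : W a' := by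
  obtain ⟨Q, q₁, q₂, m, sq', rfl, rfl, hm⟩ := h
  exact W.comp_mem _ _ hm (W.of_isPullback sq'.flip.flip ha)

/-- Corner maps are stable under base change. -/
lemma baseChange [W.IsStableUnderBaseChange] [HasPullbacks C] {Z' Z V' V : C} {f₂ : Z' ⟶ Z}
    {g₂ : V' ⟶ V}
    {b' : Z' ⟶ V'} {b : Z ⟶ V} (h : CornerMap W f g a' a)
    {s' : Z' ⟶ X'} {s : Z ⟶ X} {t' : V' ⟶ Y'} {t : V ⟶ Y}
    (sqX : IsPullback s' f₂ f s) (sqY : IsPullback t' g₂ g t)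
    (hb : s ≫ a = b ≫ t) (hb' : s' ≫ a' = b' ≫ t') (hf : f₂ ≫ b = b' ≫ g₂) :
    CornerMap W f₂ g₂ b' b := by
  obtain ⟨P, p₁, p₂, l, sq, rfl, rfl, hl⟩ := h
  have sq₂ := IsPullback.of_hasPullback b g₂
  have w : (pullback.fst b g₂ ≫ s) ≫ a = (pullback.snd b g₂ ≫ t') ≫ g := by
    rw [Category.assoc, hb, pullback.condition_assoc, Category.assoc, sqY.w]
  have e₁ : sq.lift _ _ w ≫ p₁ = pullback.fst b g₂ ≫ s := sq.lift_fst _ _ _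
  have e₂ : sq.lift _ _ w ≫ p₂ = pullback.snd b g₂ ≫ t' := sq.lift_snd _ _ _
  -- The corner of the new square is the base change of the old corner `P` along `s`; by pasting,
  -- the new corner map is then a base change of `l`.
  have sq₃ : IsPullback (sq.lift _ _ w) (pullback.fst b g₂) p₁ s := by
    refine IsPullback.of_right (h₁₂ := p₂) (v₁₃ := g) (h₂₂ := a) ?_ e₁ sq.flip
    rw [e₂, hb]
    exact sq₂.flip.paste_horiz sqY
  refine ⟨_, _, _, pullback.lift f₂ b' hf, sq₂, pullback.lift_fst _ _ _, pullback.lift_snd _ _ _,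
    W.of_isPullback (f' := s') (f := sq.lift _ _ w) (g := l) ?_ hl⟩
  refine IsPullback.of_bot (v₂₁ := pullback.fst b g₂) (v₂₂ := p₁) (h₃₁ := s) ?_ ?_ sq₃
  · rwa [pullback.lift_fst]
  · refine sq.hom_ext ?_ ?_
    · rw [Category.assoc, Category.assoc, e₁, pullback.lift_fst_assoc, sqX.w]
    · rw [Category.assoc, Category.assoc, e₂, pullback.lift_snd_assoc, hb']

end CornerMap

end Corner

/-! ### Lifting properties and first consequences of the axioms -/

/-- A weak equivalence with the right lifting property against trivial cofibrations has the right
lifting property with respect to all cofibrations. -/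
lemma hasLiftingProperty_of_we {C : Type*} [Category* C] {cof we : MorphismProperty C}
    [cof.IsMultiplicative] [we.HasTwoOutOfThreeProperty] [cof.HasFactorization we]
    (hpo : ∀ {A X B : C} (c : A ⟶ X) (f : A ⟶ B), cof c → HasPushout c f)
    (hcof : ∀ {A X B P : C} {c : A ⟶ X} {f : A ⟶ B} {f' : X ⟶ P} {c' : B ⟶ P},
      IsPushout c f f' c' → cof c → cof c') {A B X Y : C} (i : A ⟶ B) (p : X ⟶ Y)
    (hi : cof i) (hp : (cof ⊓ we).rlp p) (hp' : we p) : HasLiftingProperty i p := by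
  refine ⟨fun {f g} sq => ?_⟩
  have := hpo i f hi
  have po := IsPushout.of_hasPushout i f
  let t : pushout i f ⟶ Y := pushout.desc g p sq.w.symm
  -- Retract argument: the pushout of `i` followed by `F.i` is a cofibration out of `X`, and a weak
  -- equivalence by two out of three since `F.p` and `p` are. So `p` lifts against it, and the lift
  -- is a retraction onto `X` over `Y`.
  let F := MorphismProperty.factorizationData cof we t
  have hc : cof (pushout.inr i f ≫ F.i) := cof.comp_mem _ _ (hcof po hi) F.hi
  have e : (pushout.inr i f ≫ F.i) ≫ F.p = p := by simp [t, pushout.inr_desc]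
  have hw : we (pushout.inr i f ≫ F.i) :=
    we.of_postcomp _ F.p F.hp (by rwa [e])
  have := hp _ ⟨hc, hw⟩
  have sq' : CommSq (𝟙 X) (pushout.inr i f ≫ F.i) p F.p := ⟨by rw [e, Category.id_comp]⟩
  refine ⟨⟨⟨pushout.inl i f ≫ F.i ≫ sq'.lift, ?_, ?_⟩⟩⟩
  · rw [pushout.condition_assoc]
    have := sq'.fac_left
    rw [Category.assoc] at this
    rw [this, Category.comp_id]
  · simp [t, pushout.inl_desc]

namespace ModelData

section

variable {C : Type u} [Category.{v} C] {S : ModelData C} (hS : S.IsBasicModel)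

namespace IsBasicModel
include hS

lemma fib_respectsIso : S.fib.RespectsIso :=
  have := hS.fib_mul
  MorphismProperty.respectsIso_of_isStableUnderComposition hS.fib_iso

lemma we_respectsIso : S.we.RespectsIso :=
  have := hS.we_mul
  MorphismProperty.respectsIso_of_isStableUnderComposition hS.we_iso

lemma fib_stableUnderBaseChange : S.fib.IsStableUnderBaseChange where
  of_isPullback sq h := hS.fib_pullback sq h

lemma isFibrant_iff [HasTerminal C] {X T : C} (hT : IsTerminal T) (f : X ⟶ T) :
    S.IsFibrant X ↔ S.fib f := by
  have := hS.fib_respectsIso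
  have h : terminal.from X = f ≫ terminal.from T := Subsingleton.elim _ _
  have : IsIso (terminal.from T) := isIso_of_isTerminal hT terminalIsTerminal _
  rw [IsFibrant, h, S.fib.cancel_right_of_respectsIso]

lemma isFibrant_of_fib [HasTerminal C] {X Y : C} (f : X ⟶ Y) (hf : S.fib f) (hY : S.IsFibrant Y) :
    S.IsFibrant X := by
  have := hS.fib_mul
  have h : terminal.from X = f ≫ terminal.from Y := Subsingleton.elim _ _
  rw [IsFibrant, h]
  exact S.fib.comp_mem _ _ hf hY

end IsBasicModel

end

end ModelData

/-- Lifts against the stages of a tower assemble to a lift against the map of limits. -/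
lemma hasLiftingProperty_of_tower {C : Type*} [Category* C] {X Y : ℕᵒᵖ ⥤ C} (η : X ⟶ Y)
    {c : Cone X} {d : Cone Y} (hc : IsLimit c) (hd : IsLimit d) (g : c.pt ⟶ d.pt)
    (hg : ∀ n, g ≫ d.π.app n = c.π.app n ≫ η.app n) {A B : C} (i : A ⟶ B)
    [HasLiftingProperty i (η.app (op 0))]
    (H : ∀ n, CornerMap (fun _ _ p => HasLiftingProperty i p) (ModelData.step X n)
      (ModelData.step Y n) (η.app (op (n + 1))) (η.app (op n))) :
    HasLiftingProperty i g := by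
  refine ⟨fun {f h} sq => ?_⟩
  let L (n : ℕ) := { s : B ⟶ X.obj (op n) //
    i ≫ s = f ≫ c.π.app (op n) ∧ s ≫ η.app (op n) = h ≫ d.π.app (op n) }
  have zero : Nonempty (L 0) := by
    have sq₀ : CommSq (f ≫ c.π.app (op 0)) i (η.app (op 0)) (h ≫ d.π.app (op 0)) :=
      ⟨by rw [Category.assoc, ← hg, sq.w_assoc]⟩
    exact ⟨⟨sq₀.lift, sq₀.fac_left, sq₀.fac_right⟩⟩
  have succ : ∀ n (s : L n), ∃ t : L (n + 1), t.1 ≫ ModelData.step X n = s.1 := by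
    intro n ⟨s, hs₁, hs₂⟩
    obtain ⟨P, p₁, p₂, l, pb, hl₁, hl₂, hl⟩ := H n
    have hl : HasLiftingProperty i l := hl
    have w : s ≫ η.app (op n) = (h ≫ d.π.app (op (n + 1))) ≫ ModelData.step Y n := by
      rw [hs₂, Category.assoc, ModelData.step, d.w]
    -- Lifting against the corner map, rather than against `η` at n + 1, makes the new lift project
    -- exactly to `s`.
    have sq' : CommSq (f ≫ c.π.app (op (n + 1))) i l (pb.lift _ _ w) := ⟨by
      refine pb.hom_ext ?_ ?_
      · rw [Category.assoc, Category.assoc, Category.assoc, pb.lift_fst, hl₁, hs₁,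
          ModelData.step, c.w]
      · rw [Category.assoc, Category.assoc, Category.assoc, pb.lift_snd, hl₂, ← hg, sq.w_assoc]⟩
    refine ⟨⟨sq'.lift, sq'.fac_left, ?_⟩, ?_⟩
    · rw [← hl₂, sq'.fac_right_assoc, pb.lift_snd]
    · dsimp only
      rw [← hl₁, sq'.fac_right_assoc, pb.lift_fst]
  choose next hnext using succ
  let s (n : ℕ) : L n := Nat.rec zero.some next n
  let σ : Cone X := ⟨B, NatTrans.ofOpSequence (fun n => (s n).1) fun n => by
    exact (Category.id_comp _).trans (hnext n (s n)).symm⟩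
  refine ⟨⟨⟨hc.lift σ, ?_, ?_⟩⟩⟩
  · refine hc.hom_ext fun n => ?_
    rw [Category.assoc, hc.fac]
    exact (s n.unop).2.1
  · refine hd.hom_ext fun n => ?_
    rw [Category.assoc, hg, hc.fac_assoc]
    exact (s n.unop).2.2

/-! ### Products and towers in the global structure -/

namespace ModelData

section

variable {C : Type u} [Category.{v} C] [HasLimits C] {S : ModelData C}

/-- The hypothesis concerns chosen products, whereas evaluating a product of diagrams gives a
product that need not be the chosen one. -/
lemma ProductsPreserve.of_isLimit (hP : S.ProductsPreserve) [S.fib.RespectsIso]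
    [S.we.RespectsIso] {I : Type v}
    {B X : I → C} {f : ∀ i, B i ⟶ X i} (hX : ∀ i, S.IsFibrant (X i)) (hf : ∀ i, S.fib (f i))
    {c : Fan B} {d : Fan X} (hc : IsLimit c) (hd : IsLimit d) (g : c.pt ⟶ d.pt)
    (hg : ∀ i, g ≫ d.proj i = c.proj i ≫ f i) :
    S.fib g ∧ ((∀ i, S.we (f i)) → S.we g) := by
  have e : Arrow.mk g ≅ Arrow.mk (Limits.Pi.map f) :=
    Arrow.isoMk (hc.conePointUniqueUpToIso (limit.isLimit _))
      (hd.conePointUniqueUpToIso (limit.isLimit _)) (by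
        apply limit.hom_ext
        rintro ⟨i⟩
        simpa using! (hg i).symm)
  rw [S.fib.arrow_mk_iso_iff e, S.we.arrow_mk_iso_iff e]
  exact hP I B X f hX hf

lemma TowersPreserve.of_isLimit (hT : S.TowersPreserve) [S.fib.RespectsIso]
    [S.we.RespectsIso] {X Y : ℕᵒᵖ ⥤ C}
    (η : X ⟶ Y) (hX : S.IsFibTower X) (hY : S.IsFibTower Y) (h₀ : S.fib (η.app (op 0)))
    (h : ∀ n, CornerMap S.fib (step X n) (step Y n) (η.app (op (n + 1))) (η.app (op n)))
    {c : Cone X} {d : Cone Y} (hc : IsLimit c) (hd : IsLimit d) (g : c.pt ⟶ d.pt)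
    (hg : ∀ n, g ≫ d.π.app n = c.π.app n ≫ η.app n) :
    S.fib g ∧ ((∀ n, S.we (η.app (op n))) → S.we g) := by
  have e : Arrow.mk g ≅ Arrow.mk (limMap η) :=
    Arrow.isoMk (hc.conePointUniqueUpToIso (limit.isLimit _))
      (hd.conePointUniqueUpToIso (limit.isLimit _)) (by
        apply limit.hom_ext
        intro n
        simpa using! (hg n).symm)
  rw [S.fib.arrow_mk_iso_iff e, S.we.arrow_mk_iso_iff e]
  exact hT X Y η hX hY h₀ fun n => (h n).of_isPullback (IsPullback.of_hasPullback _ _)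
    (pullback.lift_fst _ _ _) (pullback.lift_snd _ _ _)

end

section

variable {C : Type u} [Category.{v} C] {S : ModelData C} (hS : S.IsBasicModel)
  {K : Type v} [SmallCategory K]

include hS in
lemma global_fib_multiplicative : (S.global K).fib.IsMultiplicative := by
  have := hS.fib_mul
  exact
    { id_mem := fun X => ⟨fun k => S.fib.id_mem _, MorphismProperty.id_mem _ _⟩
      comp_mem := fun f g hf hg => ⟨fun k => S.fib.comp_mem _ _ (hf.1 k) (hg.1 k),
        MorphismProperty.comp_mem _ _ _ hf.2 hg.2⟩ }

include hS in
lemma global_we_respectsIso : (S.global K).we.RespectsIso :=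
  have := hS.we_respectsIso
  { precomp := fun _ _ _ hf k => MorphismProperty.RespectsIso.precomp _ _ _ (hf k)
    postcomp := fun _ _ _ hf k => MorphismProperty.RespectsIso.postcomp _ _ _ (hf k) }

lemma cornerMap_global_rlp {X' X Y' Y : K ⥤ C} {f : X' ⟶ X} {g : Y' ⟶ Y} {a' : X' ⟶ Y'}
    {a : X ⟶ Y} (h : CornerMap (S.global K).fib f g a' a) {A B : K ⥤ C} (i : A ⟶ B)
    (hi : (S.cof.functorCategory K ⊓ S.we.functorCategory K) i) :
    CornerMap (fun _ _ p => HasLiftingProperty i p) f g a' a := by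
  obtain ⟨P, p₁, p₂, l, sq, rfl, rfl, hl⟩ := h
  exact ⟨_, _, _, _, sq, rfl, rfl, hl.2 i hi⟩

end

section

variable {C : Type u} [Category.{v} C] [HasLimits C] {S : ModelData C} (hS : S.IsBasicModel)
  {K : Type v} [SmallCategory K]

include hS in
lemma global_isFibrant_app {X : K ⥤ C} (hX : (S.global K).IsFibrant X) (k : K) :
    S.IsFibrant (X.obj k) :=
  (hS.isFibrant_iff (terminalIsTerminal.isTerminalObj ((evaluation K C).obj k)) _).2 (hX.1 k)

include hS in
lemma global_fib_stableUnderBaseChange : (S.global K).fib.IsStableUnderBaseChange where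
  of_isPullback sq h := ⟨fun k => hS.fib_pullback (sq.map ((evaluation K C).obj k)) (h.1 k),
    MorphismProperty.of_isPullback sq h.2⟩

include hS in
lemma global_fib_respectsIso : (S.global K).fib.RespectsIso :=
  have := global_fib_stableUnderBaseChange hS (K := K)
  inferInstance

lemma cornerMap_global_app {X' X Y' Y : K ⥤ C} {f : X' ⟶ X} {g : Y' ⟶ Y} {a' : X' ⟶ Y'}
    {a : X ⟶ Y} (h : CornerMap (S.global K).fib f g a' a) (k : K) :
    CornerMap S.fib (f.app k) (g.app k) (a'.app k) (a.app k) := by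
  obtain ⟨P, p₁, p₂, l, sq, rfl, rfl, hl⟩ := h
  exact ⟨_, _, _, _, sq.map ((evaluation K C).obj k), rfl, rfl, hl.1 k⟩

include hS in
theorem global_productsPreserve (hP : S.ProductsPreserve) : (S.global K).ProductsPreserve := by
  intro I B X f hX hf
  have := hS.fib_respectsIso
  have := hS.we_respectsIso
  have key (k : K) := hP.of_isLimit (fun i => global_isFibrant_app hS (hX i) k)
    (fun i => (hf i).1 k)
    (isLimitFanMkObjOfIsLimit ((evaluation K C).obj k) B _ (productIsProduct B))
    (isLimitFanMkObjOfIsLimit ((evaluation K C).obj k) X _ (productIsProduct X))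
    ((Limits.Pi.map f).app k)
    (fun i => by have := congr_app (Limits.Pi.map_π f i) k; exact this)
  exact ⟨⟨fun k => (key k).1, MorphismProperty.limMap (W := MorphismProperty.rlp _) _
    fun i => (hf i.as).2⟩, fun h k => (key k).2 fun i => h i k⟩

include hS in
-- The pointwise statements come from evaluation, which preserves limits; the lifting property is
-- assembled along the tower from lifts against the corner maps.
theorem global_towersPreserve (hT : S.TowersPreserve) : (S.global K).TowersPreserve := by
  intro X Y η hX hY h₀ h
  have := hS.fib_respectsIso
  have := hS.we_respectsIso
  have hcorner n : CornerMap (S.global K).fib (step X n) (step Y n) (η.app (op (n + 1)))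
      (η.app (op n)) :=
    ⟨_, _, _, _, IsPullback.of_hasPullback _ _, pullback.lift_fst _ _ _, pullback.lift_snd _ _ _,
      h n⟩
  have key (k : K) := hT.of_isLimit (Functor.whiskerRight η ((evaluation K C).obj k))
    ⟨global_isFibrant_app hS hX.1 k, fun n => (hX.2 n).1 k⟩
    ⟨global_isFibrant_app hS hY.1 k, fun n => (hY.2 n).1 k⟩ (h₀.1 k)
    (fun n => cornerMap_global_app (hcorner n) k)
    (isLimitOfPreserves ((evaluation K C).obj k) (limit.isLimit X))
    (isLimitOfPreserves ((evaluation K C).obj k) (limit.isLimit Y))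
    ((limMap η).app k) (fun n => congr_app (limMap_π η n) k)
  refine ⟨⟨fun k => (key k).1, fun A B i hi => ?_⟩, fun h k => (key k).2 fun n => h n k⟩
  have := h₀.2 i hi
  exact hasLiftingProperty_of_tower η (limit.isLimit X) (limit.isLimit Y) (limMap η)
    (fun n => limMap_π η n) i fun n => cornerMap_global_rlp (hcorner n) i hi

end

end ModelData

/-! ### The cofree monad -/

section

variable {K : Type v} [SmallCategory K] {C : Type u} [Category.{v} C] [HasLimits C]

/-- The product of the values of a functor at the targets of the morphisms starting at `k`. -/
noncomputable def cofreeObj (X : K ⥤ C) (k : K) : C := ∏ᶜ fun a : Σ l, (k ⟶ l) => X.obj a.1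

/-- The projections of `cofreeObj`. -/
noncomputable def cofreeObj.π (X : K ⥤ C) {k l : K} (a : k ⟶ l) : cofreeObj X k ⟶ X.obj l :=
  Pi.π (fun a : Σ l, (k ⟶ l) => X.obj a.1) ⟨l, a⟩

/-- The universal property of `cofreeObj`. -/
noncomputable def cofreeObj.lift {X : K ⥤ C} {k : K} {Z : C}
    (f : ∀ ⦃l⦄ (_ : k ⟶ l), Z ⟶ X.obj l) : Z ⟶ cofreeObj X k :=
  Pi.lift fun a : Σ l, (k ⟶ l) => f a.2

@[simp]
lemma cofreeObj.lift_π {X : K ⥤ C} {k : K} {Z : C} (f : ∀ ⦃l⦄ (_ : k ⟶ l), Z ⟶ X.obj l) {l : K}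
    (a : k ⟶ l) : cofreeObj.lift f ≫ cofreeObj.π X a = f a :=
  Pi.lift_π _ _

@[simp]
lemma cofreeObj.lift_π_assoc {X : K ⥤ C} {k : K} {Z : C} (f : ∀ ⦃l⦄ (_ : k ⟶ l), Z ⟶ X.obj l)
    {l : K} (a : k ⟶ l) {W : C} (h : X.obj l ⟶ W) :
    cofreeObj.lift f ≫ cofreeObj.π X a ≫ h = f a ≫ h := by
  rw [← Category.assoc, lift_π]

lemma cofreeObj.hom_ext {X : K ⥤ C} {k : K} {Z : C} {f g : Z ⟶ cofreeObj X k}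
    (h : ∀ ⦃l⦄ (a : k ⟶ l), f ≫ cofreeObj.π X a = g ≫ cofreeObj.π X a) : f = g :=
  Pi.hom_ext _ _ fun a => h a.2

variable (K C)

/-- The monad sending a functor `X` to the functor cofreely generated by its values. -/
noncomputable def cofreeMonad : (K ⥤ C) ⥤ (K ⥤ C) where
  obj X :=
    { obj k := cofreeObj X k
      map f := cofreeObj.lift fun _ a => cofreeObj.π X (f ≫ a)
      map_id k := cofreeObj.hom_ext fun l a => by simp
      map_comp f g := cofreeObj.hom_ext fun l a => by simp }
  map {X Y} g :=
    { app k := cofreeObj.lift fun l a => cofreeObj.π X a ≫ g.app l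
      naturality k l f := cofreeObj.hom_ext fun l a => by simp }
  map_id Y := by ext k; exact cofreeObj.hom_ext fun l a => by simp
  map_comp f g := by ext k; exact cofreeObj.hom_ext fun l a => by simp

variable {K C}

/-- The projections of a cofree functor. -/
noncomputable def cofreeProj (X : K ⥤ C) {k l : K} (a : k ⟶ l) :
    ((cofreeMonad K C).obj X).obj k ⟶ X.obj l :=
  cofreeObj.π X a

/-- The universal property of the values of a cofree functor. -/
noncomputable def cofreeLift {X : K ⥤ C} {k : K} {Z : C} (f : ∀ ⦃l⦄ (_ : k ⟶ l), Z ⟶ X.obj l) :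
    Z ⟶ ((cofreeMonad K C).obj X).obj k :=
  cofreeObj.lift f

@[simp]
lemma cofreeLift_proj {X : K ⥤ C} {k : K} {Z : C} (f : ∀ ⦃l⦄ (_ : k ⟶ l), Z ⟶ X.obj l) {l : K}
    (a : k ⟶ l) : cofreeLift f ≫ cofreeProj X a = f a :=
  cofreeObj.lift_π _ _

@[simp]
lemma cofreeLift_proj_assoc {X : K ⥤ C} {k : K} {Z : C} (f : ∀ ⦃l⦄ (_ : k ⟶ l), Z ⟶ X.obj l)
    {l : K} (a : k ⟶ l) {W : C} (h : X.obj l ⟶ W) :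
    cofreeLift f ≫ cofreeProj X a ≫ h = f a ≫ h := by
  rw [← Category.assoc, cofreeLift_proj]

lemma cofreeProj_hom_ext {X : K ⥤ C} {k : K} {Z : C} {f g : Z ⟶ ((cofreeMonad K C).obj X).obj k}
    (h : ∀ ⦃l⦄ (a : k ⟶ l), f ≫ cofreeProj X a = g ≫ cofreeProj X a) : f = g :=
  cofreeObj.hom_ext h

@[simp]
lemma cofreeMonad_map_proj {X Y : K ⥤ C} (f : X ⟶ Y) {k l : K} (a : k ⟶ l) :
    ((cofreeMonad K C).map f).app k ≫ cofreeProj Y a = cofreeProj X a ≫ f.app l :=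
  cofreeObj.lift_π (X := Y) (fun l a => cofreeObj.π X a ≫ f.app l) a

@[simp]
lemma cofreeMonad_obj_map_proj (X : K ⥤ C) {j k l : K} (f : j ⟶ k) (a : k ⟶ l) :
    ((cofreeMonad K C).obj X).map f ≫ cofreeProj X a = cofreeProj X (f ≫ a) :=
  cofreeObj.lift_π (X := X) (fun _ a => cofreeObj.π X (f ≫ a)) a

variable (K C) in
/-- The unit of the monad of cofree functors. -/
noncomputable def cofreeUnit : 𝟭 (K ⥤ C) ⟶ cofreeMonad K C where
  app X :=
    { app k := cofreeLift fun _ a => X.map a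
      naturality k l f := cofreeProj_hom_ext fun l a => by simp }
  naturality X Y f := by ext k; exact cofreeProj_hom_ext fun l a => by simp

@[simp]
lemma cofreeUnit_proj (X : K ⥤ C) {k l : K} (a : k ⟶ l) :
    ((cofreeUnit K C).app X).app k ≫ cofreeProj X a = X.map a :=
  cofreeLift_proj _ _

/-- Products commute with limits: a cone over the cofree diagrams at `k` amounts to one cone over
the values at l for each arrow k ⟶ l. -/
instance {J : Type*} [Category* J] (F : J ⥤ K ⥤ C) [HasLimitsOfShape J C] :
    PreservesLimit F (cofreeMonad K C) := by
  refine ⟨fun {c} hc => ⟨evaluationJointlyReflectsLimits _ fun k => ?_⟩⟩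
  have h (l : K) := isLimitOfPreserves ((evaluation K C).obj l) hc
  let t (s : Cone ((F ⋙ cofreeMonad K C) ⋙ (evaluation K C).obj k)) {l : K} (a : k ⟶ l) :
      Cone (F ⋙ (evaluation K C).obj l) :=
    { pt := s.pt
      π :=
        { app j := (s.π.app j : s.pt ⟶ ((cofreeMonad K C).obj (F.obj j)).obj k) ≫ cofreeProj _ a
          naturality i j f := by
            have := s.w f
            dsimp at this ⊢
            rw [← this, Category.id_comp, Category.assoc, Category.assoc]
            congr 1
            exact cofreeMonad_map_proj _ _ } }
  exact
    { lift s := cofreeLift fun l a => (h l).lift (t s a)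
      fac s j := by
        refine cofreeProj_hom_ext fun l a => ?_
        have := (h l).fac (t s a) j
        rw [Category.assoc]
        erw [cofreeMonad_map_proj]
        rw [cofreeLift_proj_assoc]
        exact this
      uniq s m hm := by
        refine cofreeProj_hom_ext fun l a => (h l).hom_ext fun j => ?_
        rw [cofreeLift_proj, (h l).fac]
        have := hm j =≫ cofreeProj _ a
        rw [Category.assoc] at this ⊢
        erw [cofreeMonad_map_proj] at this
        exact this }

end

namespace ModelData

variable {C : Type u} [Category.{v} C] [HasLimits C] {S : ModelData C} (hS : S.IsBasicModel)
  (hP : S.ProductsPreserve) {K : Type v} [SmallCategory K]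

include hS hP

/-- A natural map into a cofree diagram is determined by its components at identities, which may be
prescribed freely. A lifting problem thus splits into separate problems in `C`, one for each object,
and the chosen solutions need not be compatible. -/
lemma fib_cofreeMonad {X Y : K ⥤ C} (f : X ⟶ Y) (hf : ∀ k, S.fib (f.app k))
    (hY : ∀ k, S.IsFibrant (Y.obj k)) : (S.global K).fib ((cofreeMonad K C).map f) := by
  refine ⟨fun k => ?_, fun A B i hi => ?_⟩
  · exact (hP (Σ l, (k ⟶ l)) (fun a => X.obj a.1) (fun a => Y.obj a.1) (fun a => f.app a.1)
      (fun a => hY a.1) fun a => hf a.1).1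
  refine ⟨fun {g h} sq => ?_⟩
  have lift (k : K) : ∃ l : B.obj k ⟶ X.obj k, i.app k ≫ l = g.app k ≫ cofreeProj X (𝟙 k) ∧
      l ≫ f.app k = h.app k ≫ cofreeProj Y (𝟙 k) := by
    have := hS.lifting (i.app k) (f.app k) (hi.1 k) (hf k) (Or.inl (hi.2 k))
    have sq' : CommSq (g.app k ≫ cofreeProj X (𝟙 k)) (i.app k) (f.app k)
        (h.app k ≫ cofreeProj Y (𝟙 k)) := ⟨by
      have := congr_app sq.w k =≫ cofreeProj Y (𝟙 k)
      rw [NatTrans.comp_app, Category.assoc, cofreeMonad_map_proj] at this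
      simpa using! this⟩
    exact ⟨sq'.lift, sq'.fac_left, sq'.fac_right⟩
  choose l hl hl' using lift
  have hproj {Z W : K ⥤ C} (g : Z ⟶ (cofreeMonad K C).obj W) {j k : K} (a : j ⟶ k) :
      Z.map a ≫ g.app k ≫ cofreeProj W (𝟙 k) = g.app j ≫ cofreeProj W a := by
    rw [g.naturality_assoc, cofreeMonad_obj_map_proj, Category.comp_id]
  let L : B ⟶ (cofreeMonad K C).obj X :=
    { app k := cofreeLift fun j a => B.map a ≫ l j
      naturality j k a := cofreeProj_hom_ext fun j a => by simp }
  refine ⟨⟨⟨L, ?_, ?_⟩⟩⟩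
  · ext k
    refine cofreeProj_hom_ext fun j a => ?_
    rw [NatTrans.comp_app, Category.assoc, cofreeLift_proj, ← i.naturality_assoc, hl, hproj]
  · ext k
    refine cofreeProj_hom_ext fun j a => ?_
    rw [NatTrans.comp_app, Category.assoc, cofreeMonad_map_proj, cofreeLift_proj_assoc,
      Category.assoc, hl', hproj]

/-- For `N = E ×[T E] T H`, the projection `N k ⟶ (T H) k ⟶ H k` is a fibration. -/
lemma fib_cofreeProj {E H N : K ⥤ C} {q : H ⟶ E} (hq : ∀ k, S.fib (q.app k))
    (hE : ∀ k, S.IsFibrant (E.obj k)) {n₁ : N ⟶ E} {n₂ : N ⟶ (cofreeMonad K C).obj H}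
    (sq : IsPullback n₁ n₂ ((cofreeUnit K C).app E) ((cofreeMonad K C).map q)) (k : K) :
    S.fib (n₂.app k ≫ cofreeProj H (𝟙 k)) := by
  classical
  have sqk := sq.map ((evaluation K C).obj k)
  dsimp only [evaluation_obj_obj, evaluation_obj_map] at sqk
  -- The factor of the identity is split off. By `hn'` the component of N k in E k is determined by
  -- the one in H k, so N k ⟶ H k is the base change along `b` of the product of the maps `q` over
  -- the remaining arrows.
  let I := {a : Σ l, (k ⟶ l) // a ≠ ⟨k, 𝟙 k⟩}
  have hI := (hP I _ _ (fun a => q.app a.1.1) (fun a => hE a.1.1) fun a => hq a.1.1).1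
  let r : N.obj k ⟶ ∏ᶜ fun a : I => H.obj a.1.1 :=
    Pi.lift fun a => n₂.app k ≫ cofreeProj H a.1.2
  let b : H.obj k ⟶ ∏ᶜ fun a : I => E.obj a.1.1 := Pi.lift fun a => q.app k ≫ E.map a.1.2
  have hn {l : K} (a : k ⟶ l) : n₁.app k ≫ E.map a =
      n₂.app k ≫ cofreeProj H a ≫ q.app l := by
    have := sqk.w =≫ cofreeProj E a
    rw [Category.assoc, Category.assoc, cofreeMonad_map_proj] at this
    rw [← this, cofreeUnit_proj]
  have hn' : n₁.app k = n₂.app k ≫ cofreeProj H (𝟙 k) ≫ q.app k := by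
    rw [← hn, E.map_id, Category.comp_id]
  have pb : IsPullback r (n₂.app k ≫ cofreeProj H (𝟙 k))
      (Limits.Pi.map fun a : I => q.app a.1.1) b := by
    have w : r ≫ Limits.Pi.map (fun a : I => q.app a.1.1) =
        (n₂.app k ≫ cofreeProj H (𝟙 k)) ≫ b := by
      refine Pi.hom_ext _ _ fun a => ?_
      simp only [r, b, Category.assoc, Limits.Pi.map_π, Pi.lift_π_assoc, Pi.lift_π, ← hn]
      rw [hn', Category.assoc, Category.assoc]
    refine ⟨⟨w⟩, ⟨PullbackCone.IsLimit.mk _ ?_ ?_ ?_ ?_⟩⟩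
    · intro s
      refine sqk.lift (s.snd ≫ q.app k) (cofreeLift fun l a =>
        if h : (⟨l, a⟩ : Σ l, (k ⟶ l)) = ⟨k, 𝟙 k⟩ then
        s.snd ≫ eqToHom (by cases h; rfl) else s.fst ≫ Pi.π _ (⟨⟨l, a⟩, h⟩ : I)) ?_
      refine cofreeProj_hom_ext fun l a => ?_
      simp only [Category.assoc, cofreeUnit_proj, cofreeMonad_map_proj, cofreeLift_proj_assoc]
      split_ifs with h
      · cases h; simp
      · have := s.condition =≫ Pi.π _ (⟨⟨l, a⟩, h⟩ : I)
        simpa [b] using! this.symm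
    · intro s
      refine Pi.hom_ext _ _ fun a => ?_
      rw [Category.assoc, Pi.lift_π, sqk.lift_snd_assoc, cofreeLift_proj, dif_neg a.2]
    · intro s
      rw [sqk.lift_snd_assoc, cofreeLift_proj, dif_pos rfl]
      simp
    · intro s m h₁ h₂
      apply sqk.hom_ext
      · rw [sqk.lift_fst, hn', ← h₂]; simp
      · rw [sqk.lift_snd]
        refine cofreeProj_hom_ext fun l a => ?_
        rw [cofreeLift_proj]
        split_ifs with h
        · cases h
          rw [Category.assoc, h₂]; simp
        · rw [← h₁, Category.assoc, Category.assoc, Pi.lift_π]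
  exact hS.fib_pullback pb hI

end ModelData

/-! ### Mapping objects and path fibrations -/

lemma CornerMap.of_iso {C : Type*} [Category* C] {W : MorphismProperty C} {X' X Y' Y Z V : C}
    {f : X' ⟶ X} {g : Y' ⟶ Y} {a' : X' ⟶ Y'} {a : X ⟶ Y} (h : CornerMap W f g a' a)
    {f₂ : X' ⟶ Z} {g₂ : Y' ⟶ V} {b : Z ⟶ V} (φ : X ≅ Z) (ψ : Y ≅ V) (hb : a ≫ ψ.hom = φ.hom ≫ b)
    (hf : f₂ = f ≫ φ.hom) (hg : g₂ = g ≫ ψ.hom) : CornerMap W f₂ g₂ a' b := by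
  obtain ⟨P, p₁, p₂, l, sq, rfl, rfl, hl⟩ := h
  exact ⟨P, p₁ ≫ φ.hom, p₂, l, sq.of_iso (Iso.refl _) φ (Iso.refl _) ψ (by simp) (by simp) hb
    (by simp [hg]), by simp [hf], rfl, hl⟩

lemma preservesLimit_cospan_of_isPullback {C D : Type*} [Category* C] [Category* D] (F : C ⥤ D)
    {P X Y Z : C} {fst : P ⟶ X} {snd : P ⟶ Y} {f : X ⟶ Z} {g : Y ⟶ Z}
    (sq : IsPullback fst snd f g)
    (sq' : IsPullback (F.map fst) (F.map snd) (F.map f) (F.map g)) :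
    PreservesLimit (cospan f g) F :=
  preservesLimit_of_preserves_limit_cone sq.isLimit
    ((isLimitMapConePullbackConeEquiv F sq.w).symm sq'.isLimit)

lemma fan_isLimit_of_isIso {C I : Type*} [Category* C] {X : I → C} [HasProduct X] {P : C}
    (g : ∀ i, P ⟶ X i) [IsIso (Pi.lift g)] : Nonempty (IsLimit (Fan.mk P g)) :=
  ⟨(productIsProduct X).ofIsoLimit (Fan.ext (asIso (Pi.lift g)).symm fun i => by simp)⟩

namespace ModelData

variable {C : Type u} [Category.{v} C] [HasLimits C] {S : ModelData C}

variable (S) in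
/-- The inclusion of the fibrant objects. -/
abbrev fibrantι : S.Fibrant ⥤ C := S.IsFibrant.ι

lemma fibrant_isPullback {P B X Y : S.Fibrant} {q : P ⟶ B} {p' : P ⟶ Y} {p : B ⟶ X} {f : Y ⟶ X}
    (sq : IsPullback q.hom p'.hom p.hom f.hom) : IsPullback q p' p f :=
  IsPullback.of_map S.fibrantι (by ext; exact sq.w) sq

/-- A functor on fibrant objects that preserves products and pullbacks along fibrations. -/
structure PreservesFibrantLimits (F : S.Fibrant ⥤ C) : Prop where
  prod (I : Type v) : PreservesLimitsOfShape (Discrete I) F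
  pullback {B X Y : S.Fibrant} (p : B ⟶ X) (f : Y ⟶ X) : S.fib p.hom → PreservesLimit (cospan p f) F

lemma preservesFibrantLimits_of_isLimit (hS : S.IsBasicModel) (F : S.Fibrant ⥤ C)
    (hprod : ∀ {I : Type v} (X : I → S.Fibrant), S.IsFibrant (∏ᶜ fun i => (X i).obj))
    (hF : ∀ {I : Type v} (X : I → S.Fibrant), Nonempty (IsLimit (Fan.mk _ fun i => F.map
      (ObjectProperty.homMk (Pi.π (fun j => (X j).obj) i) :
        (⟨∏ᶜ fun j => (X j).obj, hprod X⟩ : S.Fibrant) ⟶ X i))))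
    (hF' : ∀ {P B X Y : S.Fibrant} (q : P ⟶ B) (p' : P ⟶ Y) (p : B ⟶ X) (f : Y ⟶ X),
      S.fib p.hom → IsPullback q.hom p'.hom p.hom f.hom →
      IsPullback (F.map q) (F.map p') (F.map p) (F.map f)) : PreservesFibrantLimits F where
  prod I := by
    suffices ∀ X : I → S.Fibrant, PreservesLimit (Discrete.functor X) F from
      ⟨fun {G} => preservesLimit_of_iso_diagram F (Discrete.natIsoFunctor (F := G)).symm⟩
    intro X
    let c : Fan X := Fan.mk (⟨∏ᶜ fun j => (X j).obj, hprod X⟩ : S.Fibrant)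
      fun i => ObjectProperty.homMk (Pi.π (fun j => (X j).obj) i)
    have hc : IsLimit c := isLimitOfReflects S.fibrantι
      ((isLimitMapConeFanMkEquiv _ _ _).symm (productIsProduct fun j => (X j).obj))
    exact preservesLimit_of_preserves_limit_cone hc
      ((isLimitMapConeFanMkEquiv _ _ _).symm (hF X).some)
  pullback {B X Y} p f hp := by
    have sq := IsPullback.of_hasPullback p.hom f.hom
    let P : S.Fibrant := ⟨pullback p.hom f.hom,
      hS.isFibrant_of_fib _ (hS.fib_pullback sq hp) Y.property⟩
    exact preservesLimit_cospan_of_isPullback F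
      (fibrant_isPullback (P := P) (q := ObjectProperty.homMk (pullback.fst _ _))
        (p' := ObjectProperty.homMk (pullback.snd _ _)) sq) (hF' _ _ _ _ hp sq)

namespace RightEnrichment

variable (𝓔 : S.RightEnrichment)

/-- The functor `X ↦ Map(L, X)` with values in `C`. -/
abbrev mapFrom (L : FinSSet) : S.Fibrant ⥤ C := 𝓔.Map.obj (op L) ⋙ S.fibrantι

/-- The natural transformation `Map(L', X) ⟶ Map(L, X)` induced by `L ⟶ L'`. -/
abbrev mapFromHom {L L' : FinSSet} (i : L ⟶ L') : 𝓔.mapFrom L' ⟶ 𝓔.mapFrom L :=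
  Functor.whiskerRight (𝓔.Map.map i.op) S.fibrantι

lemma mapFrom_preservesFibrantLimits (hS : S.IsBasicModel) (L : FinSSet) :
    PreservesFibrantLimits (𝓔.mapFrom L) :=
  preservesFibrantLimits_of_isLimit hS _ 𝓔.prod_fibrant (fun X =>
    have := 𝓔.map_prod L X
    fan_isLimit_of_isIso fun i => ((𝓔.Map.obj (op L)).map
      (ObjectProperty.homMk (Pi.π (fun j => (X j).obj) i) :
        (⟨∏ᶜ fun j => (X j).obj, 𝓔.prod_fibrant X⟩ : S.Fibrant) ⟶ X i)).hom)
    (fun q p' p f hp sq => 𝓔.map_baseChange L q p' p f hp sq)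

lemma cornerMap_fib {K L : FinSSet} (i : K ⟶ L) [Mono i.hom] {B X : S.Fibrant} (p : B ⟶ X)
    (hp : S.fib p.hom) : CornerMap S.fib ((𝓔.mapFromHom i).app B) ((𝓔.mapFromHom i).app X)
      ((𝓔.mapFrom L).map p) ((𝓔.mapFrom K).map p) :=
  ⟨_, _, _, _, IsPullback.of_hasPullback _ _, pullback.lift_fst _ _ _, pullback.lift_snd _ _ _,
    𝓔.corner_fib i p inferInstance hp⟩

lemma cornerMap_we {K L : FinSSet} (i : K ⟶ L) [Mono i.hom] {B X : S.Fibrant} (p : B ⟶ X)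
    (hp : S.fib p.hom) (h : IsWeakEquivSSet i.hom ∨ S.we p.hom) :
    CornerMap S.we ((𝓔.mapFromHom i).app B) ((𝓔.mapFromHom i).app X)
      ((𝓔.mapFrom L).map p) ((𝓔.mapFrom K).map p) :=
  ⟨_, _, _, _, IsPullback.of_hasPullback _ _, pullback.lift_fst _ _ _, pullback.lift_snd _ _ _,
    𝓔.corner_we i p inferInstance hp h⟩

/-- Apply the corner axiom to X ⟶ *: the objects Map(-, *) are terminal, so the corner map is the
restriction map itself up to isomorphism. -/
lemma mapFromHom_we (hS : S.IsBasicModel) {K L : FinSSet} (i : K ⟶ L) [Mono i.hom]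
    (h : IsWeakEquivSSet i.hom) (X : S.Fibrant) : S.we ((𝓔.mapFromHom i).app X) := by
  have := hS.we_respectsIso
  have hT : S.IsFibrant (⊤_ C) := (hS.isFibrant_iff terminalIsTerminal (𝟙 _)).2
    (hS.fib_iso _ (inferInstanceAs (IsIso _)))
  let T : S.Fibrant := ⟨⊤_ C, hT⟩
  let p : X ⟶ T := ObjectProperty.homMk (terminal.from X.obj)
  obtain ⟨P, p₁, p₂, l, sq, h₁, h₂, hl⟩ := 𝓔.cornerMap_we i p X.property (Or.inl h)
  have : IsIso ((𝓔.mapFromHom i).app T) := isIso_of_isTerminal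
    (𝓔.map_terminal L T ⟨terminalIsTerminal⟩).some (𝓔.map_terminal K T ⟨terminalIsTerminal⟩).some _
  have : IsIso p₁ := sq.isIso_fst_of_isIso
  rw [← h₁]
  exact MorphismProperty.RespectsIso.postcomp _ _ _ hl

end RightEnrichment

/-- The two vertices of the interval, as a finite simplicial set. -/
noncomputable def boundaryOne : FinSSet := ⟨(∂Δ[1] : SSet.{0}), inferInstance⟩

/-- A vertex of the interval. -/
noncomputable def vertex (i : Fin 2) : simplex 0 ⟶ boundaryOne :=
  ObjectProperty.homMk (SSet.boundary.ι i)

/-- The inclusion of the two vertices of the interval. -/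
noncomputable def boundaryInc : boundaryOne ⟶ simplex 1 :=
  ObjectProperty.homMk (SSet.boundary.{0} 1).ι

/-- The empty simplicial set. -/
noncomputable def emptyFinSSet : FinSSet :=
  ⟨((⊥ : (Δ[1] : SSet.{0}).Subcomplex) : SSet.{0}), inferInstance⟩

instance : Mono boundaryInc.hom := inferInstanceAs (Mono (SSet.boundary.{0} 1).ι)
instance (i : Fin 2) : Mono (vertex i ≫ boundaryInc).hom :=
  inferInstanceAs (Mono (SSet.stdSimplex.δ i))

instance (X : SSet.{0}) :
    Mono ((SSet.Subcomplex.isInitialBot (X := (Δ[1] : SSet.{0}))).to X) := by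
  rw [NatTrans.mono_iff_mono_app]
  intro n
  rw [mono_iff_injective]
  rintro ⟨x, hx⟩
  simp at hx

/-- The projection of the interval to a point. -/
noncomputable def intervalProj : simplex 1 ⟶ simplex 0 :=
  ObjectProperty.homMk (SSet.stdSimplex.isTerminalObj₀.from _)

namespace RightEnrichment

variable (𝓔 : S.RightEnrichment)

/-- Evaluation of paths at a vertex. -/
noncomputable abbrev pathEval (i : Fin 2) : 𝓔.mapFrom (simplex 1) ⟶ 𝓔.mapFrom (simplex 0) :=
  𝓔.mapFromHom (vertex i ≫ boundaryInc)

/-- Constant paths. -/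
noncomputable abbrev constPath : 𝓔.mapFrom (simplex 0) ⟶ 𝓔.mapFrom (simplex 1) :=
  𝓔.mapFromHom intervalProj

lemma mapFromHom_comp {L L' L'' : FinSSet} (i : L ⟶ L') (j : L' ⟶ L'') :
    𝓔.mapFromHom (i ≫ j) = 𝓔.mapFromHom j ≫ 𝓔.mapFromHom i := by
  rw [mapFromHom, op_comp, 𝓔.Map.map_comp, Functor.whiskerRight_comp]

lemma constPath_eval (i : Fin 2) : 𝓔.constPath ≫ 𝓔.pathEval i = 𝟙 _ := by
  rw [constPath, pathEval, ← mapFromHom_comp]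
  have : (vertex i ≫ boundaryInc) ≫ intervalProj = 𝟙 (simplex 0) := by
    ext : 1
    exact SSet.stdSimplex.isTerminalObj₀.hom_ext _ _
  rw [this, mapFromHom, op_id, 𝓔.Map.map_id, Functor.whiskerRight_id']

/-- Evaluation at the endpoints is a product decomposition. -/
lemma isLimit_boundary (X : S.Fibrant) : Nonempty (IsLimit (BinaryFan.mk
    ((𝓔.mapFromHom (vertex 0)).app X) ((𝓔.mapFromHom (vertex 1)).app X))) := by
  have sq := 𝓔.map_pushout (K := emptyFinSSet) (L := simplex 0) (K' := simplex 0)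
    (P := boundaryOne)
    (ObjectProperty.homMk (SSet.Subcomplex.isInitialBot.to _))
    (ObjectProperty.homMk (SSet.Subcomplex.isInitialBot.to _)) (vertex 0) (vertex 1) X
    (inferInstanceAs (Mono (SSet.Subcomplex.isInitialBot.to _))) boundary_one_isPushout
  have hT := (𝓔.map_empty emptyFinSSet X ⟨SSet.Subcomplex.isInitialBot⟩).some
  exact ⟨isBinaryProductOfIsTerminalIsPullback _ _ hT _ _ sq.isLimit⟩

/-- The object of pairs of endpoints. -/
noncomputable def boundaryIso (X : S.Fibrant) : (𝓔.mapFrom boundaryOne).obj X ≅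
    (𝓔.mapFrom (simplex 0)).obj X ⨯ (𝓔.mapFrom (simplex 0)).obj X :=
  (𝓔.isLimit_boundary X).some.conePointUniqueUpToIso (limit.isLimit _)

lemma boundaryIso_hom_fst (X : S.Fibrant) : (𝓔.boundaryIso X).hom ≫ prod.fst =
    (𝓔.mapFromHom (vertex 0)).app X :=
  (𝓔.isLimit_boundary X).some.conePointUniqueUpToIso_hom_comp (limit.isLimit _) ⟨WalkingPair.left⟩

lemma boundaryIso_hom_snd (X : S.Fibrant) : (𝓔.boundaryIso X).hom ≫ prod.snd =
    (𝓔.mapFromHom (vertex 1)).app X :=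
  (𝓔.isLimit_boundary X).some.conePointUniqueUpToIso_hom_comp (limit.isLimit _) ⟨WalkingPair.right⟩

/-- Evaluation of paths at both endpoints. -/
noncomputable abbrev pathEvals (X : S.Fibrant) : (𝓔.mapFrom (simplex 1)).obj X ⟶
    (𝓔.mapFrom (simplex 0)).obj X ⨯ (𝓔.mapFrom (simplex 0)).obj X :=
  prod.lift ((𝓔.pathEval 0).app X) ((𝓔.pathEval 1).app X)

lemma pathEvals_eq (X : S.Fibrant) :
    𝓔.pathEvals X = (𝓔.mapFromHom boundaryInc).app X ≫ (𝓔.boundaryIso X).hom := by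
  apply Limits.prod.hom_ext
  · rw [prod.lift_fst, pathEval, mapFromHom_comp, NatTrans.comp_app, Category.assoc,
      boundaryIso_hom_fst]
  · rw [prod.lift_snd, pathEval, mapFromHom_comp, NatTrans.comp_app, Category.assoc,
      boundaryIso_hom_snd]

/-- This is the corner axiom for ∂Δ[1] ⊆ Δ[1], with Map(∂Δ[1], -) identified with the square of
Map(Δ[0], -). -/
lemma cornerMap_pathEvals {B X : S.Fibrant} (p : B ⟶ X) (hp : S.fib p.hom) :
    CornerMap S.fib (𝓔.pathEvals B) (𝓔.pathEvals X) ((𝓔.mapFrom (simplex 1)).map p)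
      (prod.map ((𝓔.mapFrom (simplex 0)).map p) ((𝓔.mapFrom (simplex 0)).map p)) :=
  (𝓔.cornerMap_fib boundaryInc p hp).of_iso (𝓔.boundaryIso B) (𝓔.boundaryIso X) (by
    apply Limits.prod.hom_ext
    · rw [Category.assoc, Category.assoc, prod.map_fst, boundaryIso_hom_fst,
        ← Category.assoc, boundaryIso_hom_fst]
      exact (𝓔.mapFromHom (vertex 0)).naturality p
    · rw [Category.assoc, Category.assoc, prod.map_snd, boundaryIso_hom_snd,
        ← Category.assoc, boundaryIso_hom_snd]
      exact (𝓔.mapFromHom (vertex 1)).naturality p) (𝓔.pathEvals_eq B) (𝓔.pathEvals_eq X)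

lemma fib_pathEvals (hS : S.IsBasicModel) (X : S.Fibrant) : S.fib (𝓔.pathEvals X) := by
  have := hS.fib_respectsIso
  rw [pathEvals_eq]
  exact MorphismProperty.RespectsIso.postcomp _ _ _ (𝓔.map_cof boundaryInc X inferInstance)

lemma fib_pathEval (i : Fin 2) (X : S.Fibrant) : S.fib ((𝓔.pathEval i).app X) :=
  𝓔.map_cof _ X inferInstance

lemma we_pathEval (hS : S.IsBasicModel) (i : Fin 2) (X : S.Fibrant) :
    S.we ((𝓔.pathEval i).app X) :=
  𝓔.mapFromHom_we hS _ (isWeakEquivSSet_of_anodyne _ (anodyneExtensions_δ i)) X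

/-- The natural weak equivalence `X ⟶ Map(Δ[0], X)`. -/
noncomputable abbrev unitMap : S.fibrantι ⟶ 𝓔.mapFrom (simplex 0) :=
  Functor.whiskerRight 𝓔.ω S.fibrantι

end RightEnrichment

end ModelData

/-! ### Mapping path objects -/

/-- Corner maps compose horizontally. -/
lemma CornerMap.comp {C : Type*} [Category* C] [HasPullbacks C] {W : MorphismProperty C}
    [W.IsStableUnderBaseChange] [W.IsStableUnderComposition]
    {X'' X' X Y'' Y' Y : C} {f' : X'' ⟶ X'} {g' : Y'' ⟶ Y'} {a'' : X'' ⟶ Y''} {a' : X' ⟶ Y'}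
    {f : X' ⟶ X} {g : Y' ⟶ Y} {a : X ⟶ Y} (h' : CornerMap W f' g' a'' a')
    (h : CornerMap W f g a' a) : CornerMap W (f' ≫ f) (g' ≫ g) a'' a := by
  obtain ⟨P, p₁, p₂, l, sq, rfl, rfl, hl⟩ := h
  obtain ⟨Q, q₁, q₂, m, sq', rfl, rfl, hm⟩ := h'
  have sqR := IsPullback.of_hasPullback p₂ g'
  have w : (q₁ ≫ l) ≫ p₂ = q₂ ≫ g' := by rw [Category.assoc, sq'.w]
  have e₁ : sqR.lift _ _ w ≫ pullback.fst p₂ g' = q₁ ≫ l := sqR.lift_fst _ _ _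
  have e₂ : sqR.lift _ _ w ≫ pullback.snd p₂ g' = q₂ := sqR.lift_snd _ _ _
  have sq₂ : IsPullback q₁ (sqR.lift _ _ w) l (pullback.fst p₂ g') := by
    refine IsPullback.of_bot (v₂₁ := pullback.snd p₂ g') (v₂₂ := p₂) (h₃₁ := g') ?_ e₁.symm
      sqR
    rw [e₂]
    exact sq'
  refine ⟨_, pullback.fst p₂ g' ≫ p₁, pullback.snd p₂ g', m ≫ sqR.lift _ _ w,
    ?_, by simp [reassoc_of% e₁], by simp [e₂], W.comp_mem _ _ hm (W.of_isPullback sq₂ hl)⟩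
  exact (sqR.flip.paste_vert sq.flip).flip

section Path

variable {C : Type*} [Category* C] [HasBinaryProducts C] {X E M P A H : C} {e₀ e₁ : P ⟶ M}
  {f : X ⟶ M} {w : E ⟶ M} {a₁ : A ⟶ X} {a₂ : A ⟶ P} {h₁ : H ⟶ A} {h₂ : H ⟶ E}

/-- The iterated pullback `X ×[M] P ×[M] E` is the pullback of `X ⨯ E` and `P` over `M ⨯ M`. -/
lemma isPullback_path (sqA : IsPullback a₁ a₂ f e₀) (sqH : IsPullback h₁ h₂ (a₂ ≫ e₁) w) :
    IsPullback (h₁ ≫ a₂) (prod.lift (h₁ ≫ a₁) h₂) (prod.lift e₀ e₁) (prod.map f w) := by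
  have c₀ (s : PullbackCone (prod.lift e₀ e₁) (prod.map f w)) :
      (s.snd ≫ prod.fst) ≫ f = s.fst ≫ e₀ := by
    simpa [prod.lift_fst, prod.lift_snd] using (s.condition =≫ prod.fst).symm
  have c₁ (s : PullbackCone (prod.lift e₀ e₁) (prod.map f w)) :
      sqA.lift _ _ (c₀ s) ≫ a₂ ≫ e₁ = (s.snd ≫ prod.snd) ≫ w := by
    simpa [prod.lift_fst, prod.lift_snd] using (s.condition =≫ prod.snd)
  refine ⟨⟨?_⟩, ⟨PullbackCone.IsLimit.mk _ (fun s => sqH.lift _ _ (c₁ s)) ?_ ?_ ?_⟩⟩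
  · apply Limits.prod.hom_ext
    · simp [sqA.w, prod.lift_fst]
    · simpa [prod.lift_fst, prod.lift_snd] using sqH.w
  · intro s; simp
  · intro s
    apply Limits.prod.hom_ext <;> simp [prod.lift_fst, prod.lift_snd]
  · intro s m hm₁ hm₂
    refine sqH.hom_ext (sqA.hom_ext ?_ ?_) ?_
    · simp [← hm₂, prod.lift_fst, prod.lift_snd]
    · simp [← hm₁]
    · simp [← hm₂, prod.lift_fst, prod.lift_snd]

end Path

namespace ModelData

variable {C : Type u} [Category.{v} C] [HasLimits C] {S : ModelData C} (hS : S.IsBasicModel)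

include hS

lemma fib_prod_snd {X E : C} (hX : S.IsFibrant X) : S.fib (prod.snd : X ⨯ E ⟶ E) :=
  hS.fib_pullback (IsPullback.of_hasBinaryProduct' X E) hX

/-- The square of projections is a base change of the square from X ⟶ * to X' ⟶ *, whose corner map
is `a`. -/
lemma cornerMap_prod_snd {X E X' E' : C} {a : X ⟶ X'} (ha : S.fib a) (b : E ⟶ E') :
    CornerMap S.fib (prod.snd : X ⨯ E ⟶ E) (prod.snd : X' ⨯ E' ⟶ E') (prod.map a b) b := by
  have := hS.fib_stableUnderBaseChange
  have h : CornerMap S.fib (terminal.from X) (terminal.from X') a (𝟙 _) :=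
    ⟨X', terminal.from X', 𝟙 X', a, IsPullback.of_vert_isIso ⟨by simp⟩, by simp, by simp, ha⟩
  exact h.baseChange (IsPullback.of_hasBinaryProduct' X E) (IsPullback.of_hasBinaryProduct' X' E')
    (Subsingleton.elim _ _) (by simp) (by simp)

section Path

variable {X E M P A H : C} {e₀ e₁ : P ⟶ M}
  {f : X ⟶ M} {w : E ⟶ M} {a₁ : A ⟶ X} {a₂ : A ⟶ P} {h₁ : H ⟶ A} {h₂ : H ⟶ E}
  (sqA : IsPullback a₁ a₂ f e₀) (sqH : IsPullback h₁ h₂ (a₂ ≫ e₁) w)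

include sqA

include sqH in
-- `h₂` is a base change of the evaluation at both ends, H ⟶ X ⨯ E, followed by the projection to E.
lemma fib_path (he : S.fib (prod.lift e₀ e₁)) (hX : S.IsFibrant X) : S.fib h₂ := by
  have := hS.fib_mul
  have := S.fib.comp_mem _ _ (hS.fib_pullback (isPullback_path sqA sqH) he) (fib_prod_snd hS hX)
  rwa [prod.lift_snd] at this

lemma fib_path_eval (he : S.fib (prod.lift e₀ e₁)) (hX : S.IsFibrant X) : S.fib (a₂ ≫ e₁) := by
  -- With E = M and `w` the identity, H becomes A and `h₂` becomes `a₂ ≫ e₁`.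
  exact fib_path hS sqA (IsPullback.of_horiz_isIso (fst := 𝟙 _) (snd := a₂ ≫ e₁) (g := 𝟙 _)
    ⟨by simp⟩) he hX

include sqH in
-- H ⟶ A is a base change of the weak equivalence `w` along the fibration `a₂ ≫ e₁`, and A ⟶ X is a
-- base change of the trivial fibration `e₀`.
lemma we_path (he : S.fib (prod.lift e₀ e₁)) (hX : S.IsFibrant X) (he₀ : S.fib e₀)
    (he₀' : S.we e₀) (hw : S.we w) : S.we (h₁ ≫ a₁) := by
  have := hS.we_mul
  exact S.we.comp_mem _ _ (hS.we_pullback_along sqH (fib_path_eval hS sqA he hX) hw)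
    (hS.we_pullback_fib sqA.flip he₀ he₀')

include sqH in
-- Relative form of `fib_path`: both factors of `h₂`, evaluation at the ends and projection, have
-- corner maps that are fibrations, and corner maps compose.
lemma cornerMap_path {X' E' M' P' A' H' : C} {e₀' e₁' : P' ⟶ M'}
    {f' : X' ⟶ M'} {w' : E' ⟶ M'} {a₁' : A' ⟶ X'} {a₂' : A' ⟶ P'} {h₁' : H' ⟶ A'} {h₂' : H' ⟶ E'}
    (sqA' : IsPullback a₁' a₂' f' e₀') (sqH' : IsPullback h₁' h₂' (a₂' ≫ e₁') w')
    {x : X ⟶ X'} {e : E ⟶ E'} {m : M ⟶ M'} {p : P ⟶ P'} {a : A ⟶ A'} {h : H ⟶ H'}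
    (hf : f ≫ m = x ≫ f') (hw : w ≫ m = e ≫ w') (ha₁ : a₁ ≫ x = a ≫ a₁')
    (ha₂ : a₂ ≫ p = a ≫ a₂') (hh₁ : h₁ ≫ a = h ≫ h₁') (hh₂ : h₂ ≫ e = h ≫ h₂')
    (hp : CornerMap S.fib (prod.lift e₀ e₁) (prod.lift e₀' e₁') p (prod.map m m))
    (hx : S.fib x) : CornerMap S.fib h₂ h₂' h e := by
  have := hS.fib_stableUnderBaseChange
  have := hS.fib_mul
  have c₁ := hp.baseChange (b := prod.map x e) (b' := h) (isPullback_path sqA sqH)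
    (isPullback_path sqA' sqH') (by simp [hf, hw]) (by simp [ha₂, reassoc_of% hh₁]) (by
      apply Limits.prod.hom_ext <;> simp [prod.lift_fst, prod.lift_snd, ha₁, hh₂, reassoc_of% hh₁])
  have := c₁.comp (cornerMap_prod_snd hS hx e)
  rwa [prod.lift_snd, prod.lift_snd] at this

end Path

end ModelData

/-! ### One stage of the tower -/

namespace ModelData

variable {C : Type u} [Category.{v} C] [HasLimits C] {S : ModelData C}
  {K : Type v} [SmallCategory K]

section

variable {𝒳 : Type*} [Category* 𝒳] (Φ : 𝒳 ⥤ K ⥤ C) (hΦ : ∀ X k, S.IsFibrant ((Φ.obj X).obj k))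

/-- A functor with pointwise fibrant values, as a functor to diagrams of fibrant objects. -/
@[simps]
def fibrantLift : 𝒳 ⥤ K ⥤ S.Fibrant where
  obj X := S.IsFibrant.lift (Φ.obj X) (hΦ X)
  map f :=
    { app k := ObjectProperty.homMk ((Φ.map f).app k)
      naturality k l a := by ext; exact (Φ.map f).naturality a }
  map_id X := by ext; simp
  map_comp f g := by ext; simp

/-- The composition of a functor with pointwise fibrant values with a functor on fibrant objects. -/
abbrev fibrantComp (F : S.Fibrant ⥤ C) : 𝒳 ⥤ K ⥤ C :=
  fibrantLift Φ hΦ ⋙ (Functor.whiskeringRight K S.Fibrant C).obj F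

/-- Functoriality of `fibrantComp`. -/
abbrev fibrantCompMap {F G : S.Fibrant ⥤ C} (α : F ⟶ G) :
    fibrantComp Φ hΦ F ⟶ fibrantComp Φ hΦ G :=
  Functor.whiskerLeft (fibrantLift Φ hΦ) ((Functor.whiskeringRight K S.Fibrant C).map α)

/-- A natural transformation from the identity induces one from `Φ`. -/
@[simps]
def fibrantCompFrom {F : S.Fibrant ⥤ C} (α : S.fibrantι ⟶ F) : Φ ⟶ fibrantComp Φ hΦ F where
  app X :=
    { app k := α.app (((fibrantLift Φ hΦ).obj X).obj k)
      naturality k l a := α.naturality (((fibrantLift Φ hΦ).obj X).map a) }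
  naturality X Y f := by
    ext k
    exact α.naturality (((fibrantLift Φ hΦ).map f).app k)

end

variable (S K) in
/-- The inclusion of diagrams of fibrant objects. -/
abbrev diagramι : (K ⥤ S.Fibrant) ⥤ (K ⥤ C) :=
  (Functor.whiskeringRight K S.Fibrant C).obj S.fibrantι

variable (S K) in
/-- A stage of the tower defining the homotopy end. -/
structure Stage where
  /-- the functor -/
  E : (K ⥤ S.Fibrant) ⥤ (K ⥤ C)
  /-- the coaugmentation -/
  u : diagramι S K ⟶ E
  fibrant (X : K ⥤ S.Fibrant) (k : K) : S.IsFibrant ((E.obj X).obj k)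

namespace Stage

variable (T : Stage S K) (𝓔 : S.RightEnrichment)

/-- The cofree unit at the values of a stage. -/
@[simps]
noncomputable def unitAt (Φ : (K ⥤ S.Fibrant) ⥤ (K ⥤ C)) : Φ ⟶ Φ ⋙ cofreeMonad K C where
  app X := (cofreeUnit K C).app (Φ.obj X)
  naturality _ _ f := (cofreeUnit K C).naturality (Φ.map f)

/-- `Map(L, E)` -/
noncomputable abbrev map (L : FinSSet) : (K ⥤ S.Fibrant) ⥤ (K ⥤ C) :=
  fibrantComp T.E T.fibrant (𝓔.mapFrom L)

/-- `E ⟶ Map(Δ[0], E)` -/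
noncomputable abbrev ω : T.E ⟶ T.map 𝓔 (simplex 0) := fibrantCompFrom T.E T.fibrant 𝓔.unitMap

/-- Evaluation of paths in `E`. -/
noncomputable abbrev ev (i : Fin 2) : T.map 𝓔 (simplex 1) ⟶ T.map 𝓔 (simplex 0) :=
  fibrantCompMap T.E T.fibrant (𝓔.pathEval i)

/-- Constant paths in `E`. -/
noncomputable abbrev const : T.map 𝓔 (simplex 0) ⟶ T.map 𝓔 (simplex 1) :=
  fibrantCompMap T.E T.fibrant 𝓔.constPath

lemma const_ev (i : Fin 2) : T.const 𝓔 ≫ T.ev 𝓔 i = 𝟙 _ := by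
  rw [← Functor.whiskerLeft_comp, ← Functor.map_comp, 𝓔.constPath_eval,
    CategoryTheory.Functor.map_id, Functor.whiskerLeft_id']

/-- Paths in `E` starting at the image of `X`. -/
noncomputable def A : (K ⥤ S.Fibrant) ⥤ (K ⥤ C) := pullback (T.u ≫ T.ω 𝓔) (T.ev 𝓔 0)

/-- The starting point. -/
noncomputable def A₁ : T.A 𝓔 ⟶ diagramι S K := pullback.fst _ _

/-- The path. -/
noncomputable def A₂ : T.A 𝓔 ⟶ T.map 𝓔 (simplex 1) := pullback.snd _ _

lemma isPullback_A : IsPullback (T.A₁ 𝓔) (T.A₂ 𝓔) (T.u ≫ T.ω 𝓔) (T.ev 𝓔 0) :=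
  IsPullback.of_hasPullback _ _

/-- The mapping path object of `X ⟶ E`. -/
noncomputable def H : (K ⥤ S.Fibrant) ⥤ (K ⥤ C) := pullback (T.A₂ 𝓔 ≫ T.ev 𝓔 1) (T.ω 𝓔)

/-- The projection of the mapping path object to paths. -/
noncomputable def H₁ : T.H 𝓔 ⟶ T.A 𝓔 := pullback.fst _ _

/-- The projection of the mapping path object to the end point. -/
noncomputable def q : T.H 𝓔 ⟶ T.E := pullback.snd _ _

lemma isPullback_H : IsPullback (T.H₁ 𝓔) (T.q 𝓔) (T.A₂ 𝓔 ≫ T.ev 𝓔 1) (T.ω 𝓔) :=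
  IsPullback.of_hasPullback _ _

/-- The inclusion of `X` in the mapping path object by constant paths. -/
noncomputable def s : diagramι S K ⟶ T.H 𝓔 :=
  (T.isPullback_H 𝓔).lift ((T.isPullback_A 𝓔).lift (𝟙 _) (T.u ≫ T.ω 𝓔 ≫ T.const 𝓔)
    (by simp only [Category.assoc, Category.id_comp, T.const_ev 𝓔 0, Category.comp_id]))
    T.u (by
      rw [← Category.assoc, IsPullback.lift_snd, Category.assoc, Category.assoc, const_ev,
        Category.comp_id])

lemma s_q : T.s 𝓔 ≫ T.q 𝓔 = T.u := (T.isPullback_H 𝓔).lift_snd _ _ _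

lemma s_proj : T.s 𝓔 ≫ T.H₁ 𝓔 ≫ T.A₁ 𝓔 = 𝟙 _ := by
  rw [← Category.assoc, s, IsPullback.lift_fst, IsPullback.lift_fst]

/-- The functor `E ×[T E] T H` of the next stage. -/
noncomputable def N : (K ⥤ S.Fibrant) ⥤ (K ⥤ C) :=
  pullback (unitAt T.E) (Functor.whiskerRight (T.q 𝓔) (cofreeMonad K C))

/-- The transition map. -/
noncomputable def N₁ : T.N 𝓔 ⟶ T.E := pullback.fst _ _

/-- The projection to the cofree functor. -/
noncomputable def N₂ : T.N 𝓔 ⟶ T.H 𝓔 ⋙ cofreeMonad K C := pullback.snd _ _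

lemma isPullback_N : IsPullback (T.N₁ 𝓔) (T.N₂ 𝓔) (unitAt T.E)
    (Functor.whiskerRight (T.q 𝓔) (cofreeMonad K C)) :=
  IsPullback.of_hasPullback _ _

lemma unitAt_naturality {Φ Ψ : (K ⥤ S.Fibrant) ⥤ (K ⥤ C)} (α : Φ ⟶ Ψ) :
    α ≫ unitAt Ψ = unitAt Φ ≫ Functor.whiskerRight α (cofreeMonad K C) := by
  ext X : 2
  exact (cofreeUnit K C).naturality (α.app X)

/-- The coaugmentation of the next stage. -/
noncomputable def nextU : diagramι S K ⟶ T.N 𝓔 :=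
  (T.isPullback_N 𝓔).lift T.u (T.s 𝓔 ≫ unitAt _) (by
    rw [Category.assoc, ← unitAt_naturality, ← Category.assoc, s_q])

lemma nextU_N₁ : T.nextU 𝓔 ≫ T.N₁ 𝓔 = T.u := (T.isPullback_N 𝓔).lift_fst _ _ _

lemma nextU_N₂ : T.nextU 𝓔 ≫ T.N₂ 𝓔 = T.s 𝓔 ≫ unitAt _ := (T.isPullback_N 𝓔).lift_snd _ _ _

section pointwise

variable (X : K ⥤ S.Fibrant)

lemma isPullback_A_app (k : K) : IsPullback (((T.A₁ 𝓔).app X).app k) (((T.A₂ 𝓔).app X).app k)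
    ((T.u.app X).app k ≫ ((T.ω 𝓔).app X).app k) (((T.ev 𝓔 0).app X).app k) :=
  ((T.isPullback_A 𝓔).map ((evaluation _ _).obj X)).map ((evaluation _ _).obj k)

lemma isPullback_H_app (k : K) : IsPullback (((T.H₁ 𝓔).app X).app k) (((T.q 𝓔).app X).app k)
    (((T.A₂ 𝓔).app X).app k ≫ ((T.ev 𝓔 1).app X).app k) (((T.ω 𝓔).app X).app k) :=
  ((T.isPullback_H 𝓔).map ((evaluation _ _).obj X)).map ((evaluation _ _).obj k)

lemma isPullback_N_app : IsPullback ((T.N₁ 𝓔).app X) ((T.N₂ 𝓔).app X)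
    ((cofreeUnit K C).app (T.E.obj X)) ((cofreeMonad K C).map ((T.q 𝓔).app X)) :=
  (T.isPullback_N 𝓔).map ((evaluation _ _).obj X)

variable (hS : S.IsBasicModel)

include hS

lemma fib_q (k : K) : S.fib (((T.q 𝓔).app X).app k) :=
  fib_path hS (T.isPullback_A_app 𝓔 X k) (T.isPullback_H_app 𝓔 X k)
    (𝓔.fib_pathEvals hS (((fibrantLift T.E T.fibrant).obj X).obj k)) (X.obj k).property

/-- `s` is a section of the projection H ⟶ X, which is a weak equivalence by `we_path`. -/
lemma we_s (k : K) : S.we (((T.s 𝓔).app X).app k) := by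
  have := hS.saturated
  have := hS.we_mul
  have h := we_path hS (T.isPullback_A_app 𝓔 X k) (T.isPullback_H_app 𝓔 X k)
    (𝓔.fib_pathEvals hS (((fibrantLift T.E T.fibrant).obj X).obj k)) (X.obj k).property
    (𝓔.fib_pathEval 0 (((fibrantLift T.E T.fibrant).obj X).obj k))
    (𝓔.we_pathEval hS 0 (((fibrantLift T.E T.fibrant).obj X).obj k))
    (𝓔.ω_we (((fibrantLift T.E T.fibrant).obj X).obj k))
  refine S.we.of_postcomp _ _ h ?_
  have := congr_app (congr_app (T.s_proj 𝓔) X) k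
  simp only [NatTrans.comp_app] at this
  rw [this]
  exact S.we.id_mem _

variable (hP : S.ProductsPreserve)
include hP

lemma fib_N₁ : (S.global K).fib ((T.N₁ 𝓔).app X) := by
  have := global_fib_stableUnderBaseChange hS (K := K)
  exact MorphismProperty.of_isPullback (P := (S.global K).fib) (T.isPullback_N_app 𝓔 X).flip
    (fib_cofreeMonad hS hP _ (T.fib_q 𝓔 X hS) (T.fibrant X))

/-- The next stage. -/
@[simps]
noncomputable def next : Stage S K where
  E := T.N 𝓔
  u := T.nextU 𝓔
  fibrant X k := hS.isFibrant_of_fib _ ((T.fib_N₁ 𝓔 X hS hP).1 k) (T.fibrant X k)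

end pointwise

end Stage

end ModelData

/-! ### Interleaving towers -/

namespace ModelData

variable {C : Type u} [Category.{v} C] [HasLimits C] {S : ModelData C} (hS : S.IsBasicModel)

section Interleaving

variable {V G : ℕᵒᵖ ⥤ C} (q : ∀ n, G.obj (op n) ⟶ V.obj (op n))
  (a : ∀ n, V.obj (op (n + 1)) ⟶ G.obj (op n))
  (haq : ∀ n, a n ≫ q n = step V n) (hqa : ∀ n, q (n + 1) ≫ a n = step G n)

/-- A cone over one of two interleaving towers induces a cone over the other one. -/
def interleavingCone (c : Cone V) : Cone G where
  pt := c.pt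
  π := NatTrans.ofOpSequence (fun n => c.π.app (op (n + 1)) ≫ a n) fun n => by
    have h : c.π.app (op (n + 2)) ≫ step V (n + 1) = c.π.app (op (n + 1)) := c.w _
    have e : (c.π.app (op (n + 2)) ≫ a (n + 1)) ≫ step G n = c.π.app (op (n + 1)) ≫ a n := by
      rw [← hqa, ← h, ← haq, Category.assoc, Category.assoc, Category.assoc]
    exact (Category.id_comp _).trans e.symm

/-- The limits of interleaving towers agree. -/
def interleavingConeIsLimit {c : Cone V} (hc : IsLimit c) :
    IsLimit (interleavingCone q a haq hqa c) :=
  have hlift (σ : Cone G) (n : ℕ) : σ.π.app (op (n + 1)) ≫ step G n = σ.π.app (op n) := σ.w _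
  let t (σ : Cone G) : Cone V :=
    { pt := σ.pt
      π := NatTrans.ofOpSequence (fun n => σ.π.app (op n) ≫ q n) fun n => by
        have e : (σ.π.app (op (n + 1)) ≫ q (n + 1)) ≫ step V n = σ.π.app (op n) ≫ q n := by
          rw [← haq, ← hlift σ n, ← hqa, Category.assoc, Category.assoc, Category.assoc]
        exact (Category.id_comp _).trans e.symm }
  { lift σ := hc.lift (t σ)
    fac σ n := by
      have h₁ : hc.lift (t σ) ≫ c.π.app (op (n.unop + 1)) =
        σ.π.app (op (n.unop + 1)) ≫ q (n.unop + 1) := hc.fac _ _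
      have e : hc.lift (t σ) ≫ c.π.app (op (n.unop + 1)) ≫ a n.unop = σ.π.app (op n.unop) := by
        rw [reassoc_of% h₁, hqa, hlift]
      exact e
    uniq σ m hm := by
      change σ.pt ⟶ c.pt at m
      refine hc.hom_ext fun n => ?_
      have h₁ : hc.lift (t σ) ≫ c.π.app n = σ.π.app n ≫ q n.unop := hc.fac _ _
      have h₂ : m ≫ c.π.app (op (n.unop + 1)) ≫ a n.unop = σ.π.app n := hm n
      have h₃ : c.π.app (op (n.unop + 1)) ≫ step V n.unop = c.π.app n := c.w _
      have e : m ≫ c.π.app n = σ.π.app n ≫ q n.unop := by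
        rw [← h₂, ← h₃, ← haq, Category.assoc, Category.assoc]
      exact e.trans h₁.symm }

include hS in
/-- The projection of the limit of a tower of trivial fibrations is a weak equivalence. -/
lemma we_of_tower (hT : S.TowersPreserve) {d : Cone G} (hd : IsLimit d) (hG : S.IsFibTower G)
    (hw : ∀ n, S.we (G.map (homOfLE (Nat.zero_le n)).op)) : S.we (d.π.app (op 0)) := by
  have := hS.fib_mul
  have := hS.fib_respectsIso
  have := hS.we_respectsIso
  let Y : ℕᵒᵖ ⥤ C := (Functor.const _).obj (G.obj (op 0))
  let e : Cone Y := ⟨G.obj (op 0), 𝟙 _⟩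
  have he : IsLimit e :=
    { lift τ := τ.π.app (op 0)
      fac τ n := by
        have := τ.w (homOfLE (Nat.zero_le n.unop)).op
        exact (Category.comp_id _).trans (this.symm.trans (Category.comp_id _))
      uniq τ m hm := (Category.comp_id _).symm.trans (hm (op 0)) }
  let η : G ⟶ Y :=
    { app n := G.map (homOfLE (Nat.zero_le n.unop)).op
      naturality m n f := by
        refine (G.map_comp _ _).symm.trans (Eq.trans ?_ (Category.comp_id _).symm)
        rfl }
  have : IsIso (step Y 0) := inferInstanceAs (IsIso (𝟙 _))
  have h₀ : η.app (op 0) = 𝟙 _ := G.map_id _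
  have hη (n : ℕ) : step G n ≫ η.app (op n) = η.app (op (n + 1)) :=
    (η.naturality _).trans (Category.comp_id _)
  exact (hT.of_isLimit η hG ⟨hG.1, fun n => S.fib.id_mem (G.obj (op 0))⟩
    (h₀ ▸ S.fib.id_mem (G.obj (op 0)))
    -- The tower is compared with the constant tower at its bottom object. The corner there is G n
    -- itself, so the corner map is the transition map of `G`.
    (fun n => ⟨_, 𝟙 _, η.app (op n), step G n,
      have : IsIso (step Y n) := inferInstanceAs (IsIso (𝟙 _))
      IsPullback.of_horiz_isIso ⟨(Category.id_comp _).trans (Category.comp_id _).symm⟩,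
      Category.comp_id _, hη n, hG.2 n⟩)
    hd he (d.π.app (op 0)) (fun n => (Category.comp_id _).trans (d.w _).symm)).2 fun n => hw n

include hS haq hqa in
/-- The limit of a tower of fibrations which interleaves with a tower of objects weakly
equivalent to `X` is weakly equivalent to `X`. -/
lemma we_of_interleaving (hT : S.TowersPreserve) {c : Cone V} (hc : IsLimit c)
    {X : C} (x : X ⟶ c.pt) (s : ∀ n, X ⟶ G.obj (op n))
    (hs : ∀ n, x ≫ c.π.app (op (n + 1)) ≫ a n = s n)
    (hsw : ∀ n, S.we (s n)) (hq : ∀ n, S.fib (q n)) (ha : ∀ n, S.fib (a n))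
    (h₀ : S.IsFibrant (G.obj (op 0))) : S.we x := by
  have := hS.saturated
  have := hS.fib_mul
  have hσ (n : ℕ) : s n ≫ G.map (homOfLE (Nat.zero_le n)).op = s 0 := by
    have h := (interleavingCone q a haq hqa c).w (homOfLE (Nat.zero_le n)).op
    have h : (c.π.app (op (n + 1)) ≫ a n) ≫ G.map (homOfLE (Nat.zero_le n)).op =
      c.π.app (op 1) ≫ a 0 := h
    rw [← hs, ← hs, Category.assoc, h]
  -- The weak equivalences `s n` commute with the transition maps, so by two out of three every map
  -- from G n to G 0 is a weak equivalence.
  have h := we_of_tower hS hT (interleavingConeIsLimit q a haq hqa hc)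
    ⟨h₀, fun n => by rw [← hqa]; exact S.fib.comp_mem _ _ (hq _) (ha _)⟩
    fun n => S.we.of_precomp (s n) _ (hsw n) (by rw [hσ]; exact hsw 0)
  refine S.we.of_postcomp x _ h ?_
  have e : x ≫ (interleavingCone q a haq hqa c).π.app (op 0) = s 0 := hs 0
  rw [e]
  exact hsw 0

end Interleaving

variable {K : Type v} [SmallCategory K]

/-! ### From one stage to the next, absolutely and relatively -/

namespace Stage

variable (T : Stage S K) (𝓔 : S.RightEnrichment)

/-- The map `E_{n+1} k ⟶ H k`, natural only on objects of `K`. -/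
noncomputable def toH (X : K ⥤ S.Fibrant) (k : K) : ((T.N 𝓔).obj X).obj k ⟶ ((T.H 𝓔).obj X).obj k :=
  ((T.N₂ 𝓔).app X).app k ≫ cofreeProj ((T.H 𝓔).obj X) (𝟙 k)

/-- The identity component of the defining square shows that the transition map at `k` passes
through H k; this is one half of the interleaving. -/
lemma toH_q (X : K ⥤ S.Fibrant) (k : K) :
    T.toH 𝓔 X k ≫ ((T.q 𝓔).app X).app k = ((T.N₁ 𝓔).app X).app k := by
  have h := congr_app (T.isPullback_N_app 𝓔 X).w k =≫ cofreeProj _ (𝟙 k)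
  simp only [NatTrans.comp_app, Category.assoc, cofreeUnit_proj, cofreeMonad_map_proj,
    CategoryTheory.Functor.map_id, Category.comp_id] at h
  rw [toH, Category.assoc, h]

lemma nextU_toH (X : K ⥤ S.Fibrant) (k : K) :
    ((T.nextU 𝓔).app X).app k ≫ T.toH 𝓔 X k = ((T.s 𝓔).app X).app k := by
  have h := congr_app (congr_app (T.nextU_N₂ 𝓔) X) k =≫ cofreeProj ((T.H 𝓔).obj X) (𝟙 k)
  simp only [NatTrans.comp_app, Category.assoc, unitAt_app, cofreeUnit_proj,
    CategoryTheory.Functor.map_id, Category.comp_id] at h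
  rw [toH]
  exact h

variable (hP : S.ProductsPreserve)

include hS hP

lemma fib_toH (X : K ⥤ S.Fibrant) (k : K) : S.fib (T.toH 𝓔 X k) :=
  fib_cofreeProj hS hP (T.fib_q 𝓔 X hS) (T.fibrant X) (T.isPullback_N_app 𝓔 X) k

section Relative

variable {X Y : K ⥤ S.Fibrant} (f : X ⟶ Y) (hf : ∀ k, S.fib (f.app k).hom)
  (hE : ∀ k, S.fib ((T.E.map f).app k))

include hf hE

omit hP in
lemma cornerMap_q (k : K) : CornerMap S.fib (((T.q 𝓔).app X).app k) (((T.q 𝓔).app Y).app k)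
    (((T.H 𝓔).map f).app k) ((T.E.map f).app k) := by
  have nat {Φ Ψ : (K ⥤ S.Fibrant) ⥤ (K ⥤ C)} (α : Φ ⟶ Ψ) :
      (α.app X).app k ≫ (Ψ.map f).app k = (Φ.map f).app k ≫ (α.app Y).app k :=
    (congr_app (α.naturality f) k).symm
  exact cornerMap_path hS (T.isPullback_A_app 𝓔 X k) (T.isPullback_H_app 𝓔 X k)
    (T.isPullback_A_app 𝓔 Y k) (T.isPullback_H_app 𝓔 Y k)
    (x := (f.app k).hom) (m := ((T.map 𝓔 (simplex 0)).map f).app k)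
    (p := ((T.map 𝓔 (simplex 1)).map f).app k) (a := ((T.A 𝓔).map f).app k)
    (nat (T.u ≫ T.ω 𝓔)) (nat (T.ω 𝓔)) (nat (T.A₁ 𝓔)) (nat (T.A₂ 𝓔)) (nat (T.H₁ 𝓔)) (nat (T.q 𝓔))
    (𝓔.cornerMap_pathEvals (((fibrantLift T.E T.fibrant).map f).app k) (hE k)) (hf k)

/-- The cofree monad preserves the pullback defining the corner, so the corner map of the images is
the image of the pointwise fibration from `cornerMap_q`. -/
lemma cornerMap_cofree : CornerMap (S.global K).fib
    ((cofreeMonad K C).map ((T.q 𝓔).app X)) ((cofreeMonad K C).map ((T.q 𝓔).app Y))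
    ((cofreeMonad K C).map ((T.H 𝓔).map f)) ((cofreeMonad K C).map (T.E.map f)) := by
  have := hS.fib_respectsIso
  have sq := IsPullback.of_hasPullback (T.E.map f) ((T.q 𝓔).app Y)
  refine ⟨_, _, _, (cofreeMonad K C).map (sq.lift _ _ ((T.q 𝓔).naturality f).symm),
    sq.map (cofreeMonad K C), ?_, ?_, fib_cofreeMonad hS hP _ (fun k => ?_) (fun k => ?_)⟩
  · rw [← Functor.map_comp, sq.lift_fst]
  · rw [← Functor.map_comp, sq.lift_snd]
  · exact (T.cornerMap_q hS 𝓔 f hf hE k).of_isPullback (sq.map ((evaluation K C).obj k))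
      (congr_app (sq.lift_fst _ _ _) k) (congr_app (sq.lift_snd _ _ _) k)
  · exact hS.isFibrant_of_fib _ (hS.fib_pullback (sq.map ((evaluation K C).obj k)).flip
      (T.fib_q 𝓔 Y hS k)) (T.fibrant X k)

/-- The defining squares of N for `X` and `Y` exhibit this corner map as a base change of the one in
`cornerMap_cofree`. -/
lemma cornerMap_N : CornerMap (S.global K).fib ((T.N₁ 𝓔).app X) ((T.N₁ 𝓔).app Y)
    ((T.N 𝓔).map f) (T.E.map f) := by
  have := global_fib_stableUnderBaseChange hS (K := K)
  exact (T.cornerMap_cofree hS 𝓔 hP f hf hE).baseChange (T.isPullback_N_app 𝓔 X).flip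
    (T.isPullback_N_app 𝓔 Y).flip ((cofreeUnit K C).naturality _).symm
    ((T.N₂ 𝓔).naturality f).symm ((T.N₁ 𝓔).naturality f).symm

lemma fib_N_map (k : K) : S.fib (((T.N 𝓔).map f).app k) := by
  have := hS.fib_stableUnderBaseChange
  have := hS.fib_mul
  exact (cornerMap_global_app (T.cornerMap_N hS 𝓔 hP f hf hE) k).of_comp (hE k)

end Relative

end Stage

end ModelData

/-! ### Limits preserved by the stages -/

/-- A limit of functors preserves a limit cone if all of the functors preserve it. -/
lemma isLimit_mapCone_of_isLimit {I J 𝒳 D : Type*} [Category* I] [Category* J] [Category* 𝒳]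
    [Category* D] {G : I ⥤ 𝒳 ⥤ D} {Γ : Cone G}
    (hΓ : ∀ x, Nonempty (IsLimit (((evaluation 𝒳 D).obj x).mapCone Γ)))
    {F : J ⥤ 𝒳} {c : Cone F} (h : ∀ i, Nonempty (IsLimit ((G.obj i).mapCone c))) :
    Nonempty (IsLimit (Γ.pt.mapCone c)) := by
  let hΓ x := (hΓ x).some
  let h i := (h i).some
  -- A cone over F ⋙ Γ.pt projects to a cone over each F ⋙ G i; the resulting lifts to the G i at
  -- `c.pt` are compatible in i and define a map to their limit.
  let t (s : Cone (F ⋙ Γ.pt)) (i : I) : Cone (F ⋙ G.obj i) :=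
    { pt := s.pt
      π := s.π ≫ Functor.whiskerLeft F (Γ.π.app i) }
  have ht (s : Cone (F ⋙ Γ.pt)) (i : I) (j : J) :
      (h i).lift (t s i) ≫ (G.obj i).map (c.π.app j) = s.π.app j ≫ (Γ.π.app i).app (F.obj j) :=
    (h i).fac (t s i) j
  let σ (s : Cone (F ⋙ Γ.pt)) : Cone (G ⋙ (evaluation 𝒳 D).obj c.pt) :=
    { pt := s.pt
      π :=
        { app i := (h i).lift (t s i)
          naturality i i' f := by
            refine (h i').hom_ext fun j => ?_
            have e : Γ.π.app i ≫ G.map f = Γ.π.app i' := Γ.w f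
            have e : (Γ.π.app i).app (F.obj j) ≫ (G.map f).app (F.obj j) =
              (Γ.π.app i').app (F.obj j) := congr_app e _
            have key : ((h i).lift (t s i) ≫ (G.map f).app c.pt) ≫ (G.obj i').map (c.π.app j) =
                (h i').lift (t s i') ≫ (G.obj i').map (c.π.app j) := by
              rw [ht, Category.assoc, ← (G.map f).naturality, reassoc_of% ht s i j, e]
            exact ((Category.id_comp _) =≫ _).trans key.symm } }
  have hσ (s : Cone (F ⋙ Γ.pt)) (i : I) :
      (hΓ c.pt).lift (σ s) ≫ (Γ.π.app i).app c.pt = (h i).lift (t s i) := (hΓ c.pt).fac (σ s) i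
  have hnat (i : I) {x y : 𝒳} (f : x ⟶ y) :
      Γ.pt.map f ≫ (Γ.π.app i).app y = (Γ.π.app i).app x ≫ (G.obj i).map f :=
    (Γ.π.app i).naturality f
  refine ⟨{ lift s := (hΓ c.pt).lift (σ s), fac s j := ?_, uniq s m hm := ?_ }⟩
  · refine (hΓ (F.obj j)).hom_ext fun i => ?_
    have key : ((hΓ c.pt).lift (σ s) ≫ Γ.pt.map (c.π.app j)) ≫ (Γ.π.app i).app (F.obj j) =
        s.π.app j ≫ (Γ.π.app i).app (F.obj j) := by
      rw [Category.assoc, hnat, reassoc_of% hσ s i, ht]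
    exact key
  · change s.pt ⟶ Γ.pt.obj c.pt at m
    replace hm (j : J) : m ≫ Γ.pt.map (c.π.app j) = s.π.app j := hm j
    refine (hΓ c.pt).hom_ext fun i => (h i).hom_ext fun j => ?_
    have key : (m ≫ (Γ.π.app i).app c.pt) ≫ (G.obj i).map (c.π.app j) =
        ((hΓ c.pt).lift (σ s) ≫ (Γ.π.app i).app c.pt) ≫ (G.obj i).map (c.π.app j) := by
      rw [hσ, ht, Category.assoc, ← hnat, reassoc_of% hm j]
    exact key

lemma isLimit_mapCone_of_isPullback {J 𝒳 D : Type*} [Category* J] [Category* 𝒳]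
    [Category* D] [HasPullbacks D] {P X Y Z : 𝒳 ⥤ D}
    {p₁ : P ⟶ X} {p₂ : P ⟶ Y} {f : X ⟶ Z} {g : Y ⟶ Z}
    (sq : IsPullback p₁ p₂ f g) {F : J ⥤ 𝒳} {c : Cone F} (hX : Nonempty (IsLimit (X.mapCone c)))
    (hY : Nonempty (IsLimit (Y.mapCone c))) (hZ : Nonempty (IsLimit (Z.mapCone c))) :
    Nonempty (IsLimit (P.mapCone c)) := by
  refine isLimit_mapCone_of_isLimit (Γ := sq.cone)
    (fun x => ⟨isLimitOfPreserves _ sq.isLimit⟩) ?_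
  rintro (_ | _ | _)
  · exact hZ
  · exact hX
  · exact hY

namespace ModelData

variable {C : Type u} [Category.{v} C] [HasLimits C] {S : ModelData C} (hS : S.IsBasicModel)
  {K : Type v} [SmallCategory K]

namespace Stage

section

variable (T : Stage S K) (𝓔 : S.RightEnrichment)

variable {J : Type*} [Category* J] [HasLimitsOfShape J C] {F : J ⥤ K ⥤ S.Fibrant} {c : Cone F}
  (hc : Nonempty (IsLimit ((diagramι S K).mapCone c)))
  (hE : Nonempty (IsLimit (T.E.mapCone c)))
  (hM : ∀ L k, PreservesLimit (F ⋙ fibrantLift T.E T.fibrant ⋙ (evaluation K S.Fibrant).obj k)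
    (𝓔.mapFrom L))

include hE hM in
lemma isLimit_map (L : FinSSet) : Nonempty (IsLimit ((T.map 𝓔 L).mapCone c)) := by
  refine ⟨evaluationJointlyReflectsLimits _ fun k => ?_⟩
  have h₁ : IsLimit (S.fibrantι.mapCone
      ((fibrantLift T.E T.fibrant ⋙ (evaluation K S.Fibrant).obj k).mapCone c)) :=
    isLimitOfPreserves ((evaluation K C).obj k) hE.some
  have := hM L k
  exact isLimitOfPreserves (𝓔.mapFrom L) (isLimitOfReflects S.fibrantι h₁)

include hc hE hM in
lemma isLimit_H : Nonempty (IsLimit ((T.H 𝓔).mapCone c)) := by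
  have h := T.isLimit_map 𝓔 hE hM
  exact isLimit_mapCone_of_isPullback (T.isPullback_H 𝓔)
    (isLimit_mapCone_of_isPullback (T.isPullback_A 𝓔) hc (h _) (h _)) hE (h _)

include hc hE hM in
lemma isLimit_N : Nonempty (IsLimit ((T.N 𝓔).mapCone c)) :=
  isLimit_mapCone_of_isPullback (T.isPullback_N 𝓔) hE
    ⟨isLimitOfPreserves (cofreeMonad K C) (T.isLimit_H 𝓔 hc hE hM).some⟩
    ⟨isLimitOfPreserves (cofreeMonad K C) hE.some⟩

end

variable (S K) in
/-- The initial stage. -/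
@[simps]
noncomputable def zero : Stage S K where
  E := (Functor.const _).obj (⊤_ (K ⥤ C))
  u := { app X := terminal.from _ }
  fibrant X k := (hS.isFibrant_iff
    (terminalIsTerminal.isTerminalObj ((evaluation K C).obj k)) (𝟙 _)).2
      (hS.fib_iso _ (inferInstanceAs (IsIso (𝟙 _))))

end Stage

/-! ### The homotopy end -/

section

variable (𝓔 : S.RightEnrichment) (hP : S.ProductsPreserve)

variable (K) in
/-- The stages of the tower defining the homotopy end. -/
noncomputable def stage (n : ℕ) : Stage S K :=
  Nat.rec (Stage.zero S hS K) (fun _ T => T.next 𝓔 hS hP) n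

/-- The transition maps between the stages. -/
noncomputable def stageMap (n : ℕ) : (stage hS K 𝓔 hP (n + 1)).E ⟶ (stage hS K 𝓔 hP n).E :=
  (stage hS K 𝓔 hP n).N₁ 𝓔

lemma stage_u (n : ℕ) :
    (stage hS K 𝓔 hP (n + 1)).u ≫ stageMap hS 𝓔 hP n = (stage hS K 𝓔 hP n).u :=
  (stage hS K 𝓔 hP n).nextU_N₁ 𝓔

variable (K) in
/-- The tower of the stages. -/
noncomputable def stageTower : ℕᵒᵖ ⥤ (K ⥤ S.Fibrant) ⥤ (K ⥤ C) :=
  Functor.ofOpSequence (X := fun n => (stage hS K 𝓔 hP n).E) (stageMap hS 𝓔 hP)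

lemma stageTower_step (n : ℕ) : (stageTower hS K 𝓔 hP).map (homOfLE (Nat.le_succ n)).op =
    stageMap hS 𝓔 hP n :=
  Functor.ofOpSequence_map_homOfLE_succ _ n

variable (K) in
/-- The homotopy end, a functorial globally fibrant replacement of diagrams of
fibrant objects. -/
noncomputable def hoEnd : (K ⥤ S.Fibrant) ⥤ (K ⥤ C) := limit (stageTower hS K 𝓔 hP)

variable (K) in
/-- The cone of the coaugmentations. -/
noncomputable def stageCone : Cone (stageTower hS K 𝓔 hP) where
  pt := diagramι S K
  π := NatTrans.ofOpSequence (fun n => (stage hS K 𝓔 hP n).u) fun n =>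
    (Category.id_comp _).trans ((stage_u hS 𝓔 hP n).symm.trans
      (_ ≫= (stageTower_step hS 𝓔 hP n).symm))

variable (K) in
/-- The coaugmentation of the homotopy end. -/
noncomputable def toHoEnd : diagramι S K ⟶ hoEnd hS K 𝓔 hP := limit.lift _ (stageCone hS K 𝓔 hP)

/-- The projections of the homotopy end. -/
noncomputable def hoEndπ (n : ℕ) : hoEnd hS K 𝓔 hP ⟶ (stage hS K 𝓔 hP n).E :=
  limit.π (stageTower hS K 𝓔 hP) (op n)

lemma toHoEnd_π (n : ℕ) : toHoEnd hS K 𝓔 hP ≫ hoEndπ hS 𝓔 hP n = (stage hS K 𝓔 hP n).u :=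
  limit.lift_π _ _

lemma we_toHoEnd (hT : S.TowersPreserve) (X : K ⥤ S.Fibrant) (k : K) :
    S.we (((toHoEnd hS K 𝓔 hP).app X).app k) := by
  let ev := (evaluation (K ⥤ S.Fibrant) (K ⥤ C)).obj X ⋙ (evaluation K C).obj k
  let q (n : ℕ) := (((stage hS K 𝓔 hP n).q 𝓔).app X).app k
  let a (n : ℕ) : ((stage hS K 𝓔 hP (n + 1)).E.obj X).obj k ⟶
    (((stage hS K 𝓔 hP n).H 𝓔).obj X).obj k := (stage hS K 𝓔 hP n).toH 𝓔 X k
  -- The interleaved tower of the Hₙ(k) is formed only after fixing `k`, because `toH` is not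
  -- natural in `k`.
  let G : ℕᵒᵖ ⥤ C := Functor.ofOpSequence fun n => q (n + 1) ≫ a n
  refine we_of_interleaving hS (V := stageTower hS K 𝓔 hP ⋙ ev) (G := G) q a (fun n => ?_)
    (fun n => ?_) hT (isLimitOfPreserves ev (limit.isLimit _)) (((toHoEnd hS K 𝓔 hP).app X).app k)
    (fun n => (((stage hS K 𝓔 hP n).s 𝓔).app X).app k) (fun n => ?_) (fun n => ?_) (fun n => ?_)
    (fun n => ?_) ?_
  · exact ((stage hS K 𝓔 hP n).toH_q 𝓔 X k).trans
      (congr_app (congr_app (stageTower_step hS 𝓔 hP n) X) k).symm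
  · exact (Functor.ofOpSequence_map_homOfLE_succ (fun n => q (n + 1) ≫ a n) n).symm
  · have h := congr_app (congr_app (toHoEnd_π hS 𝓔 hP (n + 1)) X) k
    exact (Category.assoc _ _ _).symm.trans ((h =≫ a n).trans
      ((stage hS K 𝓔 hP n).nextU_toH 𝓔 X k))
  · exact (stage hS K 𝓔 hP n).we_s 𝓔 X hS k
  · exact (stage hS K 𝓔 hP n).fib_q 𝓔 X hS k
  · exact (stage hS K 𝓔 hP n).fib_toH hS 𝓔 hP X k
  · exact hS.isFibrant_of_fib _ ((stage hS K 𝓔 hP 0).fib_q 𝓔 X hS k)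
      ((stage hS K 𝓔 hP 0).fibrant X k)

lemma fib_stageMap (n : ℕ) (X : K ⥤ S.Fibrant) :
    (S.global K).fib ((stageMap hS 𝓔 hP n).app X) :=
  (stage hS K 𝓔 hP n).fib_N₁ 𝓔 X hS hP

variable (K) in
include hS in
lemma isFibrant_terminal : (S.global K).IsFibrant (⊤_ (K ⥤ C)) := by
  have := global_fib_multiplicative hS (K := K)
  have h : terminal.from (⊤_ (K ⥤ C)) = 𝟙 _ := Subsingleton.elim _ _
  rw [IsFibrant, h]
  exact MorphismProperty.id_mem _ _

lemma stageTower_isFibTower (X : K ⥤ S.Fibrant) : (S.global K).IsFibTower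
    (stageTower hS K 𝓔 hP ⋙ (evaluation (K ⥤ S.Fibrant) (K ⥤ C)).obj X) := by
  refine ⟨isFibrant_terminal hS K, fun n => ?_⟩
  have h := congr_app (stageTower_step hS 𝓔 hP n) X
  have h' := fib_stageMap hS 𝓔 hP n X
  rw [← h] at h'
  exact h'

lemma fib_stage_map {X Y : K ⥤ S.Fibrant} (f : X ⟶ Y) (hf : ∀ k, S.fib (f.app k).hom) (n : ℕ)
    (k : K) : S.fib (((stage hS K 𝓔 hP n).E.map f).app k) := by
  induction n generalizing k with
  | zero =>
    have := hS.fib_mul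
    exact S.fib.id_mem _
  | succ n ih => exact (stage hS K 𝓔 hP n).fib_N_map hS 𝓔 hP f hf ih k

/-- The map of limits is a global fibration because, at each transition of the two towers, the
corner map is one by `cornerMap_N`. -/
theorem fib_hoEnd_map (hT : S.TowersPreserve) {X Y : K ⥤ S.Fibrant} (f : X ⟶ Y)
    (hf : ∀ k, S.fib (f.app k).hom) : (S.global K).fib ((hoEnd hS K 𝓔 hP).map f) := by
  have := global_fib_respectsIso hS (K := K)
  have := global_we_respectsIso hS (K := K)
  have := global_fib_multiplicative hS (K := K)
  refine ((global_towersPreserve hS hT (K := K)).of_isLimit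
    (Functor.whiskerLeft (stageTower hS K 𝓔 hP) ((evaluation (K ⥤ S.Fibrant) (K ⥤ C)).map f))
    (stageTower_isFibTower hS 𝓔 hP X) (stageTower_isFibTower hS 𝓔 hP Y) ?_ (fun n => ?_)
    (isLimitOfPreserves ((evaluation (K ⥤ S.Fibrant) (K ⥤ C)).obj X) (limit.isLimit _))
    (isLimitOfPreserves ((evaluation (K ⥤ S.Fibrant) (K ⥤ C)).obj Y) (limit.isLimit _))
    ((hoEnd hS K 𝓔 hP).map f) fun n => ?_).1
  · exact MorphismProperty.id_mem (S.global K).fib (⊤_ (K ⥤ C))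
  · have h := (stage hS K 𝓔 hP n).cornerMap_N hS 𝓔 hP f hf (fib_stage_map hS 𝓔 hP f hf n)
    have hX : step (stageTower hS K 𝓔 hP ⋙ (evaluation (K ⥤ S.Fibrant) (K ⥤ C)).obj X) n =
      (stageMap hS 𝓔 hP n).app X := congr_app (stageTower_step hS 𝓔 hP n) X
    have hY : step (stageTower hS K 𝓔 hP ⋙ (evaluation (K ⥤ S.Fibrant) (K ⥤ C)).obj Y) n =
      (stageMap hS 𝓔 hP n).app Y := congr_app (stageTower_step hS 𝓔 hP n) Y
    rw [hX, hY]
    exact h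
  · exact (limit.π (stageTower hS K 𝓔 hP) n).naturality f

section Limits

variable {J : Type*} [Category* J] [HasLimitsOfShape J C] {F : J ⥤ K ⥤ S.Fibrant} {c : Cone F}
  (hc : Nonempty (IsLimit ((diagramι S K).mapCone c)))
  (hM : ∀ n L k, PreservesLimit (F ⋙ fibrantLift (stage hS K 𝓔 hP n).E (stage hS K 𝓔 hP n).fibrant ⋙
    (evaluation K S.Fibrant).obj k) (𝓔.mapFrom L))

include hc hM

/-- Each stage is built from pullbacks, the cofree monad and mapping objects. The first two commute
with all limits at hand; the mapping objects only with products and pullbacks along fibrations,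
whence the condition `hM` at every stage. -/
lemma isLimit_hoEnd : Nonempty (IsLimit ((hoEnd hS K 𝓔 hP).mapCone c)) := by
  refine isLimit_mapCone_of_isLimit (Γ := limit.cone (stageTower hS K 𝓔 hP))
    (fun X => ⟨isLimitOfPreserves _ (limit.isLimit _)⟩) ?_
  suffices ∀ n, Nonempty (IsLimit ((stage hS K 𝓔 hP n).E.mapCone c)) from fun n => this n.unop
  intro n
  induction n with
  | zero =>
    exact ⟨{ lift s := terminal.from _
             fac s j := Subsingleton.elim (α := (s.pt ⟶ ⊤_ (K ⥤ C))) _ _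
             uniq s m _ := Subsingleton.elim (α := (s.pt ⟶ ⊤_ (K ⥤ C))) _ _ }⟩
  | succ n ih => exact (stage hS K 𝓔 hP n).isLimit_N 𝓔 hc ih (hM n)

end Limits

lemma hoEnd_isLimit_fan {I : Type v} {X : I → K ⥤ S.Fibrant} {Z : K ⥤ S.Fibrant} (π : ∀ i, Z ⟶ X i)
    (h : Nonempty (IsLimit (Fan.mk _ fun i => (diagramι S K).map (π i)))) :
    Nonempty (IsLimit (Fan.mk _ fun i => (hoEnd hS K 𝓔 hP).map (π i))) := by
  have hc := isLimit_hoEnd hS 𝓔 hP (c := Fan.mk Z π)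
    ⟨(isLimitMapConeFanMkEquiv _ _ _).symm h.some⟩ fun n L k =>
      have := (𝓔.mapFrom_preservesFibrantLimits hS L).prod I
      inferInstance
  exact ⟨isLimitMapConeFanMkEquiv _ _ _ hc.some⟩

lemma hoEnd_isTerminal (Z : K ⥤ S.Fibrant) (h : ∀ k, Nonempty (IsTerminal (Z.obj k).obj)) :
    Nonempty (IsTerminal ((hoEnd hS K 𝓔 hP).obj Z)) := by
  have t (Y : K ⥤ C) : Unique (Y ⟶ (diagramι S K).obj Z) :=
    { default :=
        { app k := (h k).some.from _
          naturality k l f := (h l).some.hom_ext _ _ }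
      uniq g := by
        ext k
        exact (h k).some.hom_ext _ _ }
  -- Terminal objects are treated as products over the empty set.
  obtain ⟨hl⟩ := hoEnd_isLimit_fan hS 𝓔 hP (I := PEmpty) (X := PEmpty.elim) (Z := Z)
    (fun i => i.elim) ⟨{ lift s := (t s.pt).default
                         fac s j := j.as.elim
                         uniq s m _ := (t s.pt).uniq m }⟩
  exact ⟨IsTerminal.ofUniqueHom (fun Y => hl.lift (Fan.mk Y fun i => i.elim))
    fun Y m => hl.hom_ext fun j => j.as.elim⟩

variable (S K) in
include hS in
/-- The terminal diagram of fibrant objects. -/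
lemma exists_terminal_diagram :
    ∃ Z : K ⥤ S.Fibrant, ∀ k, Nonempty (IsTerminal (Z.obj k).obj) :=
  ⟨(Functor.const K).obj ⟨⊤_ C, (hS.isFibrant_iff terminalIsTerminal (𝟙 _)).2
    (hS.fib_iso _ (inferInstanceAs (IsIso _)))⟩, fun _ => ⟨terminalIsTerminal⟩⟩

include hS in
lemma isFibrant_hoEnd (hT : S.TowersPreserve) (X : K ⥤ S.Fibrant) :
    (S.global K).IsFibrant ((hoEnd hS K 𝓔 hP).obj X) := by
  obtain ⟨Z, hZ⟩ := exists_terminal_diagram S hS K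
  have := global_fib_respectsIso hS (K := K)
  let f : X ⟶ Z :=
    { app k := ObjectProperty.homMk ((hZ k).some.from _)
      naturality k l f := by
        ext
        exact (hZ l).some.hom_ext _ _ }
  have hf := fib_hoEnd_map hS 𝓔 hP hT f fun k =>
    (hS.isFibrant_iff (hZ k).some _).1 (X.obj k).property
  have hZ' := (hoEnd_isTerminal hS 𝓔 hP Z hZ).some
  have : IsIso (terminal.from ((hoEnd hS K 𝓔 hP).obj Z)) :=
    isIso_of_isTerminal hZ' terminalIsTerminal _
  have e : terminal.from ((hoEnd hS K 𝓔 hP).obj X) = (hoEnd hS K 𝓔 hP).map f ≫ terminal.from _ :=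
    Subsingleton.elim _ _
  rw [IsFibrant, e]
  exact MorphismProperty.RespectsIso.postcomp _ _ _ hf

lemma hoEnd_isPullback {P B X Y : K ⥤ S.Fibrant} {q : P ⟶ B} {p' : P ⟶ Y} {p : B ⟶ X} {f : Y ⟶ X}
    (hp : ∀ k, S.fib (p.app k).hom) (sq : ∀ k, IsPullback (q.app k).hom (p'.app k).hom (p.app k).hom
      (f.app k).hom) :
    IsPullback ((hoEnd hS K 𝓔 hP).map q) ((hoEnd hS K 𝓔 hP).map p') ((hoEnd hS K 𝓔 hP).map p)
      ((hoEnd hS K 𝓔 hP).map f) := by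
  have w : q ≫ p = p' ≫ f := by
    ext k
    exact (sq k).w
  have sq' : IsPullback ((diagramι S K).map q) ((diagramι S K).map p') ((diagramι S K).map p)
      ((diagramι S K).map f) := IsPullback.of_forall_isPullback_app sq
  have hc := isLimit_hoEnd hS 𝓔 hP (c := PullbackCone.mk q p' w)
    ⟨(isLimitMapConePullbackConeEquiv _ w).symm sq'.isLimit⟩ fun n L k => by
      let G := cospan p f ⋙ fibrantLift (stage hS K 𝓔 hP n).E (stage hS K 𝓔 hP n).fibrant ⋙
        (evaluation K S.Fibrant).obj k
      -- Mapping objects preserve this pullback because `p` induces a pointwise fibration on every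
      -- stage.
      have : PreservesLimit (cospan (G.map WalkingCospan.Hom.inl) (G.map WalkingCospan.Hom.inr))
          (𝓔.mapFrom L) := (𝓔.mapFrom_preservesFibrantLimits hS L).pullback
        (((fibrantLift (stage hS K 𝓔 hP n).E (stage hS K 𝓔 hP n).fibrant).map p).app k)
        (((fibrantLift (stage hS K 𝓔 hP n).E (stage hS K 𝓔 hP n).fibrant).map f).app k)
        (fib_stage_map hS 𝓔 hP p hp n k)
      exact preservesLimit_of_iso_diagram _ (diagramIsoCospan G).symm
  exact ⟨⟨by rw [← Functor.map_comp, w, Functor.map_comp]⟩,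
    ⟨isLimitMapConePullbackConeEquiv _ w hc.some⟩⟩

end

end ModelData

/-! ### Model axioms other than the second factorization -/

namespace ModelData

section

variable {C : Type u} [Category.{v} C] {S : ModelData C} (hS : S.IsBasicModel)
  {K : Type v} [SmallCategory K]

include hS

/-- `C` need not have all pushouts. Evaluation is known to preserve a pushout of diagrams once the
pushouts at all objects exist, which the cofibration provides. -/
lemma hasColimit_span_flip {A X B : K ⥤ C} (c : A ⟶ X) (f : A ⟶ B)
    (hc : (S.global K).cof c) (k : K) : HasColimit ((span c f).flip.obj k) := by
  have : HasColimit (span (((span c f).flip.obj k).map WalkingSpan.Hom.fst)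
    (((span c f).flip.obj k).map WalkingSpan.Hom.snd)) := hS.hasPushout _ (f.app k) (hc k)
  exact hasColimit_of_iso (diagramIsoSpan ((span c f).flip.obj k))

lemma global_isPushout_app {A X B P : K ⥤ C} {c : A ⟶ X} {f : A ⟶ B} {f' : X ⟶ P} {c' : B ⟶ P}
    (sq : IsPushout c f f' c') (hc : (S.global K).cof c) (k : K) :
    IsPushout (c.app k) (f.app k) (f'.app k) (c'.app k) := by
  have := hasColimit_span_flip hS c f hc
  exact sq.map ((evaluation K C).obj k)

lemma global_hasPushout {A X B : K ⥤ C} (c : A ⟶ X) (f : A ⟶ B) (hc : (S.global K).cof c) :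
    HasPushout c f := by
  have := hasColimit_span_flip hS c f hc
  exact functorCategoryHasColimit _

lemma global_cof_multiplicative : (S.global K).cof.IsMultiplicative :=
  have := hS.cof_mul
  { id_mem := fun _ _ => S.cof.id_mem _
    comp_mem := fun _ _ hf hg k => S.cof.comp_mem _ _ (hf k) (hg k) }

lemma global_we_multiplicative : (S.global K).we.IsMultiplicative :=
  have := hS.we_mul
  { id_mem := fun _ _ => S.we.id_mem _
    comp_mem := fun _ _ hf hg k => S.we.comp_mem _ _ (hf k) (hg k) }

lemma global_we_twoOutOfThree : (S.global K).we.HasTwoOutOfThreeProperty :=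
  have := hS.saturated
  { comp_mem := fun _ _ hf hg k => S.we.comp_mem _ _ (hf k) (hg k)
    of_postcomp := fun f g hg hfg k => S.we.of_postcomp (f.app k) (g.app k) (hg k) (hfg k)
    of_precomp := fun f g hf hfg k => S.we.of_precomp (f.app k) (g.app k) (hf k) (hfg k) }

end

section

variable {C : Type u} [Category.{v} C] [HasLimits C] {S : ModelData C}
  {K : Type v} [SmallCategory K]

/-- The global structure is a Thomason model structure as soon as it has functorial
factorizations into weak equivalences and fibrations. -/
lemma global_isThomasonModel_of_factorization (hS : S.IsThomasonModel)
    (hF : (S.global K).we.HasFunctorialFactorization (S.global K).fib) :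
    (S.global K).IsThomasonModel := by
  have := hS.hasInitial
  have := hS.functorial_cof
  have hB := hS.toIsBasicModel
  -- Functoriality of the factorization in `C` is what turns pointwise factorizations into diagrams.
  have hcof : (S.global K).cof.HasFunctorialFactorization (S.global K).we :=
    inferInstanceAs ((S.cof.functorCategory K).HasFunctorialFactorization (S.we.functorCategory K))
  have := hS.retract
  have mul := global_cof_multiplicative hB (K := K)
  have sat := global_we_twoOutOfThree hB (K := K)
  have fibmul := global_fib_multiplicative hB (K := K)
  have app {P X Y Z : K ⥤ C} {a : P ⟶ X} {b : P ⟶ Y} {c : X ⟶ Z} {d : Y ⟶ Z}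
      (sq : IsPullback a b c d) (k : K) := sq.map ((evaluation K C).obj k)
  exact
    { hasInitial := inferInstance
      hasTerminal := inferInstance
      cof_mul := mul
      fib_mul := fibmul
      we_mul := global_we_multiplicative hB
      cof_iso := fun _ _ f (hf : IsIso f) k => hB.cof_iso _ (inferInstanceAs (IsIso (f.app k)))
      fib_iso := fun _ _ f (hf : IsIso f) => by
        have := global_fib_respectsIso hB (K := K)
        exact MorphismProperty.of_isIso (S.global K).fib f
      we_iso := fun _ _ f (hf : IsIso f) k => hB.we_iso _ (inferInstanceAs (IsIso (f.app k)))
      hasPushout := fun c f => global_hasPushout hB c f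
      cof_pushout := fun sq hc k => hB.cof_pushout (global_isPushout_app hB sq hc k) (hc k)
      we_pushout_cof := fun sq hc hw k =>
        hB.we_pushout_cof (global_isPushout_app hB sq hc k) (hc k) (hw k)
      we_pushout_along := fun sq hc hw k =>
        hB.we_pushout_along (global_isPushout_app hB sq hc k) (hc k) (hw k)
      hasPullback := fun _ _ _ => inferInstance
      fib_pullback := fun sq hp =>
        have := global_fib_stableUnderBaseChange hB (K := K)
        MorphismProperty.of_isPullback sq hp
      we_pullback_fib := fun sq hp hw k => hB.we_pullback_fib (app sq k) (hp.1 k) (hw k)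
      we_pullback_along := fun sq hp hw k => hB.we_pullback_along (app sq k) (hp.1 k) (hw k)
      saturated := sat
      retract := inferInstanceAs (S.we.functorCategory K).IsStableUnderRetracts
      lifting := fun i p hi hp h => by
        rcases h with h | h
        · exact hp.2 i ⟨hi, h⟩
        -- Lifting against trivial cofibrations is part of the definition of a global fibration; the
        -- case of a trivial fibration needs the retract argument.
        · exact hasLiftingProperty_of_we (cof := (S.global K).cof) (we := (S.global K).we)
            (fun c f => global_hasPushout hB c f)
            (fun sq hc k => hB.cof_pushout (global_isPushout_app hB sq hc k) (hc k)) i p hi hp.2 h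
      factor_cof := inferInstance
      factor_fib := inferInstance
      functorial_cof := hcof
      functorial_fib := hF }

end

/-! ### Functorial factorization into weak equivalences and global fibrations -/

section Factorization

variable {C : Type u} [Category.{v} C] [HasLimits C] {S : ModelData C} (hS : S.IsBasicModel)
  {K : Type v} [SmallCategory K]

/-- The functor sending an object to its map to the terminal object. -/
@[simps]
noncomputable def toTerminal (D : Type*) [Category* D] [HasTerminal D] : D ⥤ Arrow D where
  obj X := Arrow.mk (terminal.from X)
  map f := Arrow.homMk f (𝟙 _)

variable (Φ : MorphismProperty.FunctorialFactorizationData (S.we.functorCategory K)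
  (S.fib.functorCategory K))

/-- The pointwise fibrant replacement. -/
noncomputable def replacement : (K ⥤ C) ⥤ (K ⥤ C) := toTerminal (K ⥤ C) ⋙ Φ.Z

/-- The map to the pointwise fibrant replacement. -/
noncomputable def toReplacement : 𝟭 (K ⥤ C) ⟶ replacement Φ where
  app X := Φ.i.app ((toTerminal (K ⥤ C)).obj X)
  naturality _ _ f := Φ.i.naturality ((toTerminal (K ⥤ C)).map f)

lemma we_toReplacement (X : K ⥤ C) (k : K) : S.we (((toReplacement Φ).app X).app k) :=
  Φ.hi ((toTerminal (K ⥤ C)).obj X) k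

include hS in
lemma isFibrant_replacement (X : K ⥤ C) (k : K) :
    S.IsFibrant (((replacement Φ).obj X).obj k) :=
  (hS.isFibrant_iff (terminalIsTerminal.isTerminalObj ((evaluation K C).obj k)) _).2
    (Φ.hp ((toTerminal (K ⥤ C)).obj X) k)

/-- The functor sending `A ⟶ B` to its composition with the fibrant replacement of `B`. -/
@[simps]
noncomputable def composeReplacement : Arrow (K ⥤ C) ⥤ Arrow (K ⥤ C) where
  obj f := Arrow.mk (f.hom ≫ (toReplacement Φ).app f.right)
  map {f g} a := Arrow.homMk a.left ((replacement Φ).map a.right) (by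
    have := (toReplacement Φ).naturality a.right
    dsimp at this ⊢
    rw [Category.assoc, ← this, ← Arrow.w_assoc])
  map_id f := by ext : 1 <;> simp
  map_comp a b := by ext : 1 <;> simp

/-- The intermediate object of the factorization of `A ⟶ B ⟶ R B`. -/
noncomputable def middle : Arrow (K ⥤ C) ⥤ (K ⥤ C) := composeReplacement Φ ⋙ Φ.Z

/-- The first map of the factorization of `A ⟶ B ⟶ R B`. -/
noncomputable def toMiddle : Arrow.leftFunc ⟶ middle Φ where
  app f := Φ.i.app ((composeReplacement Φ).obj f)
  naturality _ _ a := Φ.i.naturality ((composeReplacement Φ).map a)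

/-- The second map of the factorization of `A ⟶ B ⟶ R B`. -/
noncomputable def middleTo : middle Φ ⟶ Arrow.rightFunc ⋙ replacement Φ where
  app f := Φ.p.app ((composeReplacement Φ).obj f)
  naturality _ _ a := Φ.p.naturality ((composeReplacement Φ).map a)

lemma toMiddle_middleTo : toMiddle Φ ≫ middleTo Φ =
    Arrow.leftToRight ≫ Functor.whiskerLeft Arrow.rightFunc (toReplacement Φ) := by
  ext f : 2
  exact Φ.fac_app (f := (composeReplacement Φ).obj f)

include hS in
lemma isFibrant_middle (f : Arrow (K ⥤ C)) (k : K) : S.IsFibrant (((middle Φ).obj f).obj k) :=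
  hS.isFibrant_of_fib (((middleTo Φ).app f).app k) (Φ.hp _ k)
    (isFibrant_replacement hS Φ f.right k)

variable (𝓔 : S.RightEnrichment) (hP : S.ProductsPreserve)

/-- The homotopy end applied to the values of a functor with pointwise fibrant values. -/
noncomputable abbrev hoEndComp {𝒳 : Type*} [Category* 𝒳] (F : 𝒳 ⥤ K ⥤ C)
    (hF : ∀ X k, S.IsFibrant ((F.obj X).obj k)) : 𝒳 ⥤ K ⥤ C :=
  fibrantLift F hF ⋙ hoEnd hS K 𝓔 hP

/-- The coaugmentation of the homotopy end, applied to a functor with pointwise fibrant values. -/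
noncomputable def toHoEndComp {𝒳 : Type*} [Category* 𝒳] (F : 𝒳 ⥤ K ⥤ C)
    (hF : ∀ X k, S.IsFibrant ((F.obj X).obj k)) : F ⟶ hoEndComp hS 𝓔 hP F hF :=
  Functor.whiskerLeft (fibrantLift F hF) (toHoEnd hS K 𝓔 hP)

/-- Functoriality of `fibrantLift`. -/
@[simps]
def fibrantLiftMap {𝒳 : Type*} [Category* 𝒳] {F G : 𝒳 ⥤ K ⥤ C}
    (hF : ∀ X k, S.IsFibrant ((F.obj X).obj k)) (hG : ∀ X k, S.IsFibrant ((G.obj X).obj k))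
    (α : F ⟶ G) : fibrantLift F hF ⟶ fibrantLift G hG where
  app X :=
    { app k := ObjectProperty.homMk ((α.app X).app k)
      naturality k l a := by ext; exact (α.app X).naturality a }
  naturality X Y f := by
    ext k
    exact congr_app (α.naturality f) k

lemma toHoEndComp_naturality {𝒳 : Type*} [Category* 𝒳] {F G : 𝒳 ⥤ K ⥤ C}
    (hF : ∀ X k, S.IsFibrant ((F.obj X).obj k)) (hG : ∀ X k, S.IsFibrant ((G.obj X).obj k))
    (α : F ⟶ G) : α ≫ toHoEndComp hS 𝓔 hP G hG = toHoEndComp hS 𝓔 hP F hF ≫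
      Functor.whiskerRight (fibrantLiftMap hF hG α) (hoEnd hS K 𝓔 hP) := by
  ext X : 2
  exact (toHoEnd hS K 𝓔 hP).naturality ((fibrantLiftMap hF hG α).app X)

include hS 𝓔 hP in
-- The middle object is the pullback of hoEnd Q ⟶ hoEnd RB along `b` : B ⟶ hoEnd RB. The replacement
-- RB is needed since `hoEnd` accepts only pointwise fibrant diagrams.
theorem global_functorial_fib (hT : S.TowersPreserve)
    (hF : S.we.HasFunctorialFactorization S.fib) :
    (S.global K).we.HasFunctorialFactorization (S.global K).fib := by
  obtain ⟨Φ⟩ : Nonempty (MorphismProperty.FunctorialFactorizationData (S.we.functorCategory K)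
    (S.fib.functorCategory K)) :=
    ⟨(MorphismProperty.functorialFactorizationData S.we S.fib).functorCategory K⟩
  have := global_fib_stableUnderBaseChange hS (K := K)
  have := global_we_twoOutOfThree hS (K := K)
  have hR (f : Arrow (K ⥤ C)) := isFibrant_replacement hS Φ f.right
  have hQ := isFibrant_middle hS Φ
  let b := Functor.whiskerLeft Arrow.rightFunc (toReplacement Φ) ≫
    toHoEndComp hS 𝓔 hP (Arrow.rightFunc ⋙ replacement Φ) hR
  let e := Functor.whiskerRight (fibrantLiftMap hQ hR (middleTo Φ)) (hoEnd hS K 𝓔 hP)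
  have w : Arrow.leftToRight ≫ b = (toMiddle Φ ≫ toHoEndComp hS 𝓔 hP (middle Φ) hQ) ≫ e := by
    rw [Category.assoc, ← toHoEndComp_naturality hS 𝓔 hP hQ hR (middleTo Φ), ← Category.assoc,
      ← Category.assoc, toMiddle_middleTo]
  have sq := IsPullback.of_hasPullback b e
  have sq' (f : Arrow (K ⥤ C)) := sq.map ((evaluation _ _).obj f)
  have hwe (f : Arrow (K ⥤ C)) (k : K) : S.we ((b.app f).app k) := by
    have := hS.we_mul
    exact S.we.comp_mem _ _ (we_toReplacement Φ f.right k) (we_toHoEnd hS 𝓔 hP hT _ k)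
  have hfib (f : Arrow (K ⥤ C)) : (S.global K).fib (e.app f) :=
    fib_hoEnd_map hS 𝓔 hP hT _ fun k => Φ.hp _ k
  have hi : sq.lift _ _ w ≫ pullback.snd b e = toMiddle Φ ≫ toHoEndComp hS 𝓔 hP (middle Φ) hQ :=
    sq.lift_snd _ _ w
  refine ⟨⟨
    { Z := pullback b e
      i := sq.lift _ _ w
      p := pullback.fst b e
      fac := sq.lift_fst _ _ w
      hi := fun f => ?_
      hp := fun f =>
        MorphismProperty.of_isPullback (P := (S.global K).fib) (sq' f).flip (hfib f) }⟩⟩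
  -- Properness: the projection to hoEnd Q is a base change of the weak equivalence `b` along a
  -- fibration. As A ⟶ Q ⟶ hoEnd Q is a weak equivalence, so is the map from A to the pullback.
  have h₁ : (S.global K).we ((pullback.snd b e).app f) := fun k =>
    hS.we_pullback_along ((sq' f).map ((evaluation K C).obj k)).flip ((hfib f).1 k) (hwe f k)
  have h₂ : (S.global K).we ((toMiddle Φ ≫ toHoEndComp hS 𝓔 hP (middle Φ) hQ).app f) := fun k =>
    have := hS.we_mul
    S.we.comp_mem _ _ (Φ.hi ((composeReplacement Φ).obj f) k)
      (we_toHoEnd hS 𝓔 hP hT ((fibrantLift (middle Φ) hQ).obj f) k)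
  have h₃ : (sq.lift _ _ w).app f ≫ (pullback.snd b e).app f = _ := congr_app hi f
  rw [← h₃] at h₂
  exact (S.global K).we.of_postcomp _ _ h₁ h₂

theorem global_isThomasonModel (hS : S.IsThomasonModel) (𝓔 : S.RightEnrichment)
    (hP : S.ProductsPreserve) (hT : S.TowersPreserve) : (S.global K).IsThomasonModel :=
  global_isThomasonModel_of_factorization hS
    (global_functorial_fib hS.toIsBasicModel 𝓔 hP hT hS.functorial_fib)

end Factorization

end ModelData

/-! ### The enrichment of the diagram category -/

namespace ModelData

variable {C : Type u} [Category.{v} C] [HasLimits C] {S : ModelData C} (hS : S.IsBasicModel)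
  {K : Type v} [SmallCategory K] (𝓔 : S.RightEnrichment) (hP : S.ProductsPreserve)
  (hT : S.TowersPreserve)

section

lemma toHoEnd_comp_map {X Y Z : K ⥤ S.Fibrant} (f : X ⟶ Y) (g : Y ⟶ Z) :
    ((diagramι S K).map f ≫ (toHoEnd hS K 𝓔 hP).app Y) ≫ (hoEnd hS K 𝓔 hP).map g =
      (diagramι S K).map (f ≫ g) ≫ (toHoEnd hS K 𝓔 hP).app Z := by
  rw [Functor.map_comp, Category.assoc, Category.assoc, (toHoEnd hS K 𝓔 hP).naturality]

include hT in
lemma we_hoEnd_map {X Y : K ⥤ S.Fibrant} (f : X ⟶ Y) (hf : ∀ k, S.we (f.app k).hom) :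
    (S.global K).we ((hoEnd hS K 𝓔 hP).map f) := by
  intro k
  have := hS.saturated
  have h : (f.app k).hom ≫ ((toHoEnd hS K 𝓔 hP).app Y).app k =
      ((toHoEnd hS K 𝓔 hP).app X).app k ≫ ((hoEnd hS K 𝓔 hP).map f).app k :=
    congr_app ((toHoEnd hS K 𝓔 hP).naturality f) k
  refine S.we.of_precomp _ _ (we_toHoEnd hS 𝓔 hP hT X k) ?_
  rw [← h]
  exact S.we.comp_mem _ _ (hf k) (we_toHoEnd hS 𝓔 hP hT Y k)

variable {X' X Y' Y : K ⥤ S.Fibrant} {f : X' ⟶ X} {g : Y' ⟶ Y} {a' : X' ⟶ Y'} {a : X ⟶ Y}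

/-- The homotopy end preserves corner maps. -/
lemma cornerMap_hoEnd (w : f ≫ a = a' ≫ g) (ha : ∀ k, S.fib (a.app k).hom)
    {W : MorphismProperty C} [W.RespectsIso] {W' : MorphismProperty (K ⥤ C)}
    (hW : ∀ {X Y : K ⥤ S.Fibrant} (f : X ⟶ Y), (∀ k, W (f.app k).hom) →
      W' ((hoEnd hS K 𝓔 hP).map f))
    (h : ∀ k, CornerMap W (f.app k).hom (g.app k).hom (a'.app k).hom (a.app k).hom) :
    CornerMap W' ((hoEnd hS K 𝓔 hP).map f) ((hoEnd hS K 𝓔 hP).map g)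
      ((hoEnd hS K 𝓔 hP).map a') ((hoEnd hS K 𝓔 hP).map a) := by
  have sq := IsPullback.of_hasPullback ((diagramι S K).map a) ((diagramι S K).map g)
  have sqk (k : K) := sq.map ((evaluation K C).obj k)
  -- The corner is again pointwise fibrant, so `hoEnd` applies to it. Since `hoEnd` preserves this
  -- pullback, the corner map of the images is the image of the corner map `l`.
  let P : K ⥤ S.Fibrant := S.IsFibrant.lift (pullback ((diagramι S K).map a) ((diagramι S K).map g))
    fun k => hS.isFibrant_of_fib _ (hS.fib_pullback (sqk k) (ha k)) (Y'.obj k).property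
  let p₁ : P ⟶ X :=
    { app k := ObjectProperty.homMk
        ((pullback.fst ((diagramι S K).map a) ((diagramι S K).map g)).app k)
      naturality k l x := by
        ext
        exact (pullback.fst ((diagramι S K).map a) ((diagramι S K).map g)).naturality x }
  let p₂ : P ⟶ Y' :=
    { app k := ObjectProperty.homMk
        ((pullback.snd ((diagramι S K).map a) ((diagramι S K).map g)).app k)
      naturality k l x := by
        ext
        exact (pullback.snd ((diagramι S K).map a) ((diagramι S K).map g)).naturality x }
  have w' : (diagramι S K).map f ≫ (diagramι S K).map a =
      (diagramι S K).map a' ≫ (diagramι S K).map g := by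
    rw [← Functor.map_comp, w, Functor.map_comp]
  let l : X' ⟶ P :=
    { app k := ObjectProperty.homMk ((sq.lift _ _ w').app k)
      naturality k l x := by
        ext
        exact (sq.lift _ _ w').naturality x }
  have hl₁ : l ≫ p₁ = f := by
    ext k
    exact congr_app (sq.lift_fst _ _ w') k
  have hl₂ : l ≫ p₂ = a' := by
    ext k
    exact congr_app (sq.lift_snd _ _ w') k
  exact ⟨_, _, _, (hoEnd hS K 𝓔 hP).map l, hoEnd_isPullback hS 𝓔 hP (q := p₁) (p' := p₂) ha sqk,
    by rw [← Functor.map_comp, hl₁], by rw [← Functor.map_comp, hl₂],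
    hW l fun k => (h k).of_isPullback (sqk k) (congr_app (sq.lift_fst _ _ w') k)
      (congr_app (sq.lift_snd _ _ w') k)⟩

end

variable (K) in
/-- The underlying diagram of fibrant objects of a globally fibrant diagram. -/
noncomputable abbrev globalDiagram : (S.global K).Fibrant ⥤ K ⥤ S.Fibrant :=
  fibrantLift (S.global K).fibrantι fun X => global_isFibrant_app hS X.property

/-- The pointwise mapping objects of a globally fibrant diagram. -/
noncomputable abbrev pointwiseMap : FinSSetᵒᵖ ⥤ (S.global K).Fibrant ⥤ K ⥤ S.Fibrant :=
  𝓔.Map ⋙ Functor.whiskeringRight K _ _ ⋙ (Functor.whiskeringLeft _ _ _).obj (globalDiagram hS K)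

/-- The mapping objects in the global structure. -/
noncomputable def globalMap : FinSSetᵒᵖ ⥤ (S.global K).Fibrant ⥤ (S.global K).Fibrant where
  obj L := (S.global K).IsFibrant.lift ((pointwiseMap hS 𝓔).obj L ⋙ hoEnd hS K 𝓔 hP)
    fun X => isFibrant_hoEnd hS 𝓔 hP hT _
  map i :=
    { app X := ObjectProperty.homMk ((hoEnd hS K 𝓔 hP).map (((pointwiseMap hS 𝓔).map i).app X))
      naturality X Y f := by
        ext : 1
        exact (Functor.whiskerRight ((pointwiseMap hS 𝓔).map i) (hoEnd hS K 𝓔 hP)).naturality f }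
  map_id L := by
    ext X : 3
    exact congr_app (((Functor.whiskeringRight _ _ _).obj (hoEnd hS K 𝓔 hP)).congr_map
      ((pointwiseMap hS 𝓔).map_id L) |>.trans (CategoryTheory.Functor.map_id _ _)) X
  map_comp i j := by
    ext X : 3
    exact congr_app (((Functor.whiskeringRight _ _ _).obj (hoEnd hS K 𝓔 hP)).congr_map
      ((pointwiseMap hS 𝓔).map_comp i j) |>.trans (Functor.map_comp _ _ _)) X

/-- The unit of the mapping objects in the global structure. -/
noncomputable def globalUnit :
    𝟭 (S.global K).Fibrant ⟶ (globalMap hS 𝓔 hP hT).obj (op (simplex 0)) where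
  app X := ObjectProperty.homMk
    ((diagramι S K).map (Functor.whiskerLeft ((globalDiagram hS K).obj X) 𝓔.ω) ≫
      (toHoEnd hS K 𝓔 hP).app (((pointwiseMap hS 𝓔).obj (op (simplex 0))).obj X))
  naturality X Y f := by
    have h₁ : (globalDiagram hS K).map f ≫ Functor.whiskerLeft ((globalDiagram hS K).obj Y) 𝓔.ω =
        Functor.whiskerLeft ((globalDiagram hS K).obj X) 𝓔.ω ≫
          ((pointwiseMap hS 𝓔).obj (op (simplex 0))).map f := by
      ext k : 2
      exact 𝓔.ω.naturality (((globalDiagram hS K).map f).app k)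
    ext : 1
    exact (Functor.map_comp_assoc _ _ _ _).symm.trans
      (((diagramι S K).congr_map h₁ =≫ _).trans (toHoEnd_comp_map hS 𝓔 hP _ _).symm)

/-- Naturality moves the coaugmentation past the map induced by `d`, so independence of `d` reduces
to the same property of `ω` in `C`. -/
lemma globalUnit_comp_map (X : (S.global K).Fibrant) (d : simplex 1 ⟶ simplex 0) :
    ((globalUnit hS 𝓔 hP hT).app X ≫ ((globalMap hS 𝓔 hP hT).map d.op).app X).hom =
      (diagramι S K).map (Functor.whiskerLeft ((globalDiagram hS K).obj X) (𝓔.ω ≫ 𝓔.Map.map d.op)) ≫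
        (toHoEnd hS K 𝓔 hP).app (((pointwiseMap hS 𝓔).obj (op (simplex 1))).obj X) :=
  toHoEnd_comp_map hS 𝓔 hP _ _

include hS hP in
lemma global_prod_fibrant (hG : (S.global K).IsBasicModel) {I : Type v}
    (X : I → (S.global K).Fibrant) :
    (S.global K).IsFibrant (∏ᶜ fun i => (X i).obj) := by
  have h := (global_productsPreserve hS hP I (fun i => (X i).obj) (fun _ => ⊤_ (K ⥤ C))
    (fun i => terminal.from _) (fun i => isFibrant_terminal hS K) fun i => (X i).property).1
  have t : IsTerminal (∏ᶜ fun _ : I => ⊤_ (K ⥤ C)) :=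
    IsTerminal.ofUniqueHom (fun Y => Pi.lift fun _ => terminal.from Y)
      fun Y m => Pi.hom_ext _ _ fun i => Subsingleton.elim _ _
  exact (hG.isFibrant_iff t _).2 h

lemma isIso_lift_of_isLimit_fan {D I : Type*} [Category* D] {X : I → D} [HasProduct X] {P : D}
    {g : ∀ i, P ⟶ X i} (h : Nonempty (IsLimit (Fan.mk P g))) : IsIso (Pi.lift g) := by
  have e : Pi.lift g = (h.some.conePointUniqueUpToIso (productIsProduct X)).hom :=
    Pi.hom_ext _ _ fun i => by
      rw [Pi.lift_π]
      exact (h.some.conePointUniqueUpToIso_hom_comp (productIsProduct X) ⟨i⟩).symm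
  rw [e]
  infer_instance

lemma pointwiseMap_isLimit_fan (L : FinSSet) {I : Type v} {X : I → (S.global K).Fibrant}
    {Z : (S.global K).Fibrant} (π : ∀ i, Z ⟶ X i)
    (h : Nonempty (IsLimit (Fan.mk Z.obj fun i => (π i).hom))) :
    Nonempty (IsLimit (Fan.mk _ fun i =>
      (diagramι S K).map (((pointwiseMap hS 𝓔).obj (op L)).map (π i)))) := by
  refine ⟨evaluationJointlyReflectsLimits _ fun k => (isLimitMapConeFanMkEquiv _ _ _).symm ?_⟩
  have := (𝓔.mapFrom_preservesFibrantLimits hS L).prod I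
  have h₁ : IsLimit (Fan.mk (((globalDiagram hS K).obj Z).obj k)
      fun i => ((globalDiagram hS K).map (π i)).app k) :=
    isLimitOfReflects S.fibrantι ((isLimitMapConeFanMkEquiv _ _ _).symm
      (isLimitFanMkObjOfIsLimit ((evaluation K C).obj k) _ _ h.some))
  exact isLimitFanMkObjOfIsLimit (𝓔.mapFrom L) _ _ h₁

include hS 𝓔 hP hT in
theorem global_rightEnrichment (hG : (S.global K).IsBasicModel) :
    Nonempty (S.global K).RightEnrichment := by
  have := hS.fib_respectsIso
  have := hS.we_respectsIso
  have := global_fib_respectsIso hS (K := K)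
  have := global_we_respectsIso hS (K := K)
  -- One argument serves both halves of the corner axiom, with `W` and `W'` the fibrations or the
  -- weak equivalences of `C` and of the global structure.
  have corner {L M : FinSSet} (i : L ⟶ M) {B X : (S.global K).Fibrant} (p : B ⟶ X)
    (hp : (S.global K).fib p.hom)
    {W : MorphismProperty C} [W.RespectsIso] {W' : MorphismProperty (K ⥤ C)} [W'.RespectsIso]
    (hW : ∀ {X Y : K ⥤ S.Fibrant} (f : X ⟶ Y), (∀ k, W (f.app k).hom) →
      W' ((hoEnd hS K 𝓔 hP).map f))
    (h : ∀ k, CornerMap W ((𝓔.mapFromHom i).app (((globalDiagram hS K).obj B).obj k))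
      ((𝓔.mapFromHom i).app (((globalDiagram hS K).obj X).obj k))
      ((𝓔.mapFrom M).map (((globalDiagram hS K).map p).app k))
      ((𝓔.mapFrom L).map (((globalDiagram hS K).map p).app k))) :
      W' (pullback.lift
        (f := (((globalMap hS 𝓔 hP hT).obj (op L)).map p).hom)
        (g := (((globalMap hS 𝓔 hP hT).map i.op).app X).hom)
        (((globalMap hS 𝓔 hP hT).map i.op).app B).hom
        (((globalMap hS 𝓔 hP hT).obj (op M)).map p).hom
        (congrArg (fun m => m.hom) (((globalMap hS 𝓔 hP hT).map i.op).naturality p).symm)) :=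
    (cornerMap_hoEnd hS 𝓔 hP (((pointwiseMap hS 𝓔).map i.op).naturality p).symm
      (fun k => 𝓔.map_fib L _ (hp.1 k)) hW h).of_isPullback (IsPullback.of_hasPullback _ _)
        (pullback.lift_fst _ _ _) (pullback.lift_snd _ _ _)
  exact ⟨
    { Map := globalMap hS 𝓔 hP hT
      map_terminal := fun L T ⟨h⟩ => hoEnd_isTerminal hS 𝓔 hP _ fun k =>
        𝓔.map_terminal L _ ⟨h.isTerminalObj ((evaluation K C).obj k)⟩
      map_fib := fun L B X p hp => fib_hoEnd_map hS 𝓔 hP hT _ fun k => 𝓔.map_fib L _ (hp.1 k)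
      map_baseChange := fun L P B X Y q p' p f hp sq =>
        hoEnd_isPullback hS 𝓔 hP (fun k => 𝓔.map_fib L _ (hp.1 k)) fun k =>
          𝓔.map_baseChange L (((globalDiagram hS K).map q).app k)
            (((globalDiagram hS K).map p').app k) (((globalDiagram hS K).map p).app k)
            (((globalDiagram hS K).map f).app k) (hp.1 k) (sq.map ((evaluation K C).obj k))
      map_empty := fun E X h => hoEnd_isTerminal hS 𝓔 hP _ fun k => 𝓔.map_empty E _ h
      map_cof := fun i X hi => fib_hoEnd_map hS 𝓔 hP hT _ fun k => 𝓔.map_cof i _ hi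
      map_pushout := fun i f f' i' X hi sq => hoEnd_isPullback hS 𝓔 hP (fun k => 𝓔.map_cof i _ hi)
        fun k => 𝓔.map_pushout i f f' i' _ hi sq
      corner_fib := fun i B X p hi hp => corner i p hp (fun f hf => fib_hoEnd_map hS 𝓔 hP hT f hf)
        fun k => 𝓔.cornerMap_fib i _ (hp.1 k)
      corner_we := fun i B X p hi hp h => corner i p hp (fun f hf => we_hoEnd_map hS 𝓔 hP hT f hf)
        fun k => 𝓔.cornerMap_we i _ (hp.1 k) (h.imp_right fun h => h k)
      ω := globalUnit hS 𝓔 hP hT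
      ω_we := fun X k =>
        have := hS.we_mul
        S.we.comp_mem _ _ (𝓔.ω_we _) (we_toHoEnd hS 𝓔 hP hT _ k)
      ω_comm := fun X d d' => by
        have e : Functor.whiskerLeft ((globalDiagram hS K).obj X) (𝓔.ω ≫ 𝓔.Map.map d.op) =
            Functor.whiskerLeft ((globalDiagram hS K).obj X) (𝓔.ω ≫ 𝓔.Map.map d'.op) := by
          ext k : 2
          exact 𝓔.ω_comm _ d d'
        ext : 1
        rw [globalUnit_comp_map, globalUnit_comp_map, e]
      prod_fibrant := global_prod_fibrant hS hP hG
      map_prod := fun L I X => isIso_lift_of_isLimit_fan (hoEnd_isLimit_fan hS 𝓔 hP _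
        (pointwiseMap_isLimit_fan hS 𝓔 L _ ⟨productIsProduct fun i => (X i).obj⟩)) }⟩

end ModelData

end Thomason

theorem theorem7p2 {C : Type u} [Category.{v} C] [HasLimits C]
    (S : Thomason.ModelData C) (hS : S.IsThomasonModel)
    (hE : Nonempty S.RightEnrichment)
    (hP : S.ProductsPreserve) (hT : S.TowersPreserve)
    (K : Type v) [SmallCategory K] :
    (S.global K).IsThomasonModel ∧
      Nonempty (S.global K).RightEnrichment ∧
      (S.global K).ProductsPreserve ∧ (S.global K).TowersPreserve := by
  obtain ⟨𝓔⟩ := hE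
  have hG := Thomason.ModelData.global_isThomasonModel (K := K) hS 𝓔 hP hT
  exact ⟨hG, Thomason.ModelData.global_rightEnrichment hS.toIsBasicModel 𝓔 hP hT hG.toIsBasicModel,
    Thomason.ModelData.global_productsPreserve hS.toIsBasicModel hP,
    Thomason.ModelData.global_towersPreserve hS.toIsBasicModel hT⟩
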